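/- **Setting.** Let $C$ be a field of characteristic $0$, $t_0:=x$, and $K_0=(C(x),d/dx)$. Let $K_0\subset K_1\subset\dots\subset K_n$ be a *primitive tower*: for $1\le i\le n$, $K_i=K_{i-1}(t_i)$ is a differential field extension of $K_{i-1}$ in which $t_i$ is transcendental over $K_{i-1}$, $t_i'\in K_{i-1}$, and every constant of $K_i$ lies in $K_{i-1}$ (so the field of constants of $K_n$ is $C$). Put $K_{-1}=C$ and $K_n'=\{u' : u\in K_n\}$. *Proper and simple.* An element of $K_i=K_{i-1}(t_i)$ is *$t_i$-proper* if its numerator has lower degree in $t_i$ than its denominator; it is *$t_i$-simple* if moreover its reduced denominator $q\in K_{i-1}[t_i]$ satisfies $\gcd(q,q')=1$ ($0\le i\le n$). *Matryoshka decomposition.* Let $T_i$ be the monoid generated by $t_{i+1},\dots,t_n$. Let $P_0=K_0[t_1,\dots,t_n]$ and, for $1\le i\le n$, let $P_i$ be the set of all sums of terms $aM$ with $M\in T_i$ and $a\in K_i$ $t_i$-proper. Then $K_n=\bigoplus_{i=0}^nP_i$; let $\pi_i$ be the projection onto $P_i$. An element $f\in K_n$ is *simple* if $\pi_i(f)$ is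 $t_i$-simple for all $0\le i\le n$. The tower is *S-primitive* if $t_1',\dots,t_n'$ are simple. *Order.* Order $T_0$ purely lexicographically with $t_1\prec\dots\prec t_n$, and regard $0$ as the lowest monomial. Let $\mathrm{hm}_i(f)$ be the highest monomial of $\pi_i(f)$ and $\mathrm{hc}_i(f)$ its coefficient (both $0$ if $\pi_i(f)=0$). Put $\mathrm{hm}(f)=\max_i\mathrm{hm}_i(f)$ and $\mathrm{hc}(f)=\sum_{i:\,\mathrm{hm}_i(f)=\mathrm{hm}(f)}\mathrm{hc}_i(f)$. Write $f\prec g$ if the reduced denominator of $f$ has lower degree in $t_n$ than that of $g$, or these degrees agree and $\mathrm{hm}(f)\prec\mathrm{hm}(g)$. A *remainder* of $f$ is a $\prec$-minimal element of $\{g\in K_n: g-f\in K_n'\}$. The *indicator* $\mathrm{ind}(M)$ of a monomial $M\in T_0$ is the least $i\ge 1$ such that $t_i$ occurs in $M$, and $n$ if $M=1$. *Steps.* For a coefficient $a$ of $P_i$ (an element of $K_0$ if $i=0$, a $t_i$-proper element if $i\ge1$), a *Hermite reduction* of $a$ is an identity $a=b'+h$ with $b$ again a coefficient of $P_i$ and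 $h$ $t_i$-simple. A state $(g,r)\in K_n^2$ stands for $g'+r$. A *step* replaces $(g,r)$ by $(g+u,\,r-u')$, where $u$ is one of the following. In (2) and (3), $M=\mathrm{hm}(r-\pi_n(r))\ne0$, $a=\mathrm{hc}(r-\pi_n(r))$ and $m=\mathrm{ind}(M)$. 1. If $\pi_n(r)$ is not $t_n$-simple: $u=b$ for a Hermite reduction $\pi_n(r)=b'+h$. 2. If $a$ is not simple: $u=\big(\sum_{i<m}b_i\big)M$ for Hermite reductions $\pi_i(a)=b_i'+h_i$, $0\le i<m$ (integration by parts). 3. If $a=\sum_{j=1}^mc_jt_j'$ with $c_j\in C$: $u=\big(\sum_{j=1}^{m-1}c_jt_j\big)M+\frac{c_m}{d+1}t_mM$, where $d$ is the exponent of $t_m$ in $M$ (integration by parts). **Theorem.** Suppose the tower is S-primitive, and let $f\in K_n$. (a) Every sequence of steps that starts at $(0,f)$ is finite; in particular, some state to which no step applies is reached from $(0,f)$ after finitely many steps. (b) If $(g,r)$ is reached from $(0,f)$ and no step applies to it, then $f=g'+r$, the element $r$ is a remainder of $f$, and either $r=0$, or $\pi_n(r)$ is $t_n$-simple and $\mathrm{hc}(r-\pi_n(r))$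 is simple and is not a nonzero element of $\mathrm{span}_C\{t_1',\dots,t_m'\}$, where $m=\mathrm{ind}(\mathrm{hm}(r))$. (c) For every remainder $r$ of $f$ (in particular, for the one constructed in (b)), $f\in K_n'$ if and only if $r=0$. -/

import Mathlib

open scoped Classical

noncomputable section

namespace PrimitiveTower

variable {C K : Type*} [Field C] [Field K] [Algebra C K] {n : ℕ}

/-! The generators are `t 0, t 1, …, t n` with `t 0 = x`; the field `K` is `K_n`. -/

/-- `K_{i-1} = C(t_0, …, t_{i-1})`; for `i = 0` this is `C`. -/
def below (C : Type*) {K : Type*} [Field C] [Field K] [Algebra C K] {n : ℕ}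
    (t : Fin (n + 1) → K) (i : Fin (n + 1)) : IntermediateField C K :=
  IntermediateField.adjoin C (t '' {j | j < i})

/-- `K_i = C(t_0, …, t_i)`. -/
def upto (C : Type*) {K : Type*} [Field C] [Field K] [Algebra C K] {n : ℕ}
    (t : Fin (n + 1) → K) (i : Fin (n + 1)) : IntermediateField C K :=
  IntermediateField.adjoin C (t '' {j | j ≤ i})

/-- A primitive tower `K_0 ⊂ K_1 ⊂ ⋯ ⊂ K_n = K` over `K_0 = (C(x), d/dx)`: `x = t 0` is
transcendental over `C` with `x' = 1` (and `c' = 0` for `c ∈ C`, as `D` is `C`-linear), and for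
`0 < i` the generator `t i` is transcendental over `K_{i-1}`, its derivative lies in `K_{i-1}`, and
`K_i = K_{i-1}(t i)` has no constants besides those of `K_{i-1}`. -/
structure IsPrimitive (D : Derivation C K K) (t : Fin (n + 1) → K) : Prop where
  transcendental : ∀ i, Transcendental (below C t i) (t i)
  deriv_x : D (t 0) = 1
  deriv_mem : ∀ i, 0 < i → D (t i) ∈ below C t i
  constants : ∀ i, 0 < i → ∀ f ∈ upto C t i, D f = 0 → f ∈ below C t i
  top : upto C t (Fin.last n) = ⊤

/-- `f` is `t_i`-proper: an element of `K_i = K_{i-1}(t_i)` whose numerator has smaller degree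
in `t_i` than its denominator. -/
def IsProper (C : Type*) {K : Type*} [Field C] [Field K] [Algebra C K] {n : ℕ}
    (t : Fin (n + 1) → K) (i : Fin (n + 1)) (f : K) : Prop :=
  ∃ p q : Polynomial (below C t i), p.degree < q.degree ∧
    f = Polynomial.aeval (t i) p / Polynomial.aeval (t i) q

/-- `f` is `t_i`-simple: it is `t_i`-proper and its (reduced) denominator `q` is `t_i`-normal,
that is, coprime in `K_{i-1}[t_i]` to its derivative `e = q'`. -/
def IsSimpleAt (D : Derivation C K K) (t : Fin (n + 1) → K) (i : Fin (n + 1)) (f : K) : Prop :=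
  ∃ p q e : Polynomial (below C t i), p.degree < q.degree ∧ IsCoprime p q ∧
    f = Polynomial.aeval (t i) p / Polynomial.aeval (t i) q ∧
    Polynomial.aeval (t i) e = D (Polynomial.aeval (t i) q) ∧ IsCoprime q e

/-- The power product `t_0 ^ e_0 ⋯ t_n ^ e_n`. -/
def mon (t : Fin (n + 1) → K) (e : Fin (n + 1) → ℕ) : K := ∏ j, t j ^ e j

/-- The exponent vectors of `T_i`, the monoid generated by `t_{i+1}, …, t_n`. -/
def InT (i : Fin (n + 1)) (e : Fin (n + 1) → ℕ) : Prop := ∀ j ≤ i, e j = 0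

/-- The coefficients that are allowed in `P_i`: all of `K_0` for `i = 0`, and the `t_i`-proper
elements for `0 < i`. -/
def IsCoeff (C : Type*) {K : Type*} [Field C] [Field K] [Algebra C K] {n : ℕ}
    (t : Fin (n + 1) → K) (i : Fin (n + 1)) (a : K) : Prop :=
  (i = 0 ∧ a ∈ upto C t 0) ∨ (0 < i ∧ IsProper C t i a)

/-- The element `∑ e, c e * t ^ e`. -/
def evalMon (t : Fin (n + 1) → K) (c : (Fin (n + 1) → ℕ) →₀ K) : K :=
  c.sum fun e a => a * mon t e

/-- `c i e` is the coefficient of `t ^ e ∈ T_i` in the component of `f` in `P_i`, for all `i`: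
the matryoshka decomposition `f = ∑ i, π_i(f)` with `π_i(f) = ∑ e, c i e * t ^ e ∈ P_i`. -/
structure IsMatryoshka (C : Type*) {K : Type*} [Field C] [Field K] [Algebra C K] {n : ℕ}
    (t : Fin (n + 1) → K) (c : Fin (n + 1) → (Fin (n + 1) → ℕ) →₀ K) (f : K) : Prop where
  inT : ∀ i e, c i e ≠ 0 → InT i e
  isCoeff : ∀ i e, IsCoeff C t i (c i e)
  sum_eq : f = ∑ i, evalMon t (c i)

theorem IsProper.of_zero {t : Fin (n + 1) → K} {i : Fin (n + 1)} : IsProper C t i (0 : K) :=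
  ⟨0, 1, by simp, by simp⟩

theorem aeval_ne_zero {t : Fin (n + 1) → K} {i : Fin (n + 1)}
    (h : Transcendental (below C t i) (t i)) {q : Polynomial (below C t i)} (hq : q ≠ 0) :
    Polynomial.aeval (t i) q ≠ 0 := fun h0 => hq ((transcendental_iff.1 h) q h0)

theorem IsProper.sub {t : Fin (n + 1) → K} {i : Fin (n + 1)}
    (h : Transcendental (below C t i) (t i)) {a b : K}
    (ha : IsProper C t i a) (hb : IsProper C t i b) : IsProper C t i (a - b) := by
  obtain ⟨p, q, hpq, rfl⟩ := ha
  obtain ⟨r, s, hrs, rfl⟩ := hb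
  have hq : q ≠ 0 := by rintro rfl; simp at hpq
  have hs : s ≠ 0 := by rintro rfl; simp at hrs
  refine ⟨p * s - q * r, q * s, ?_, ?_⟩
  · refine (Polynomial.degree_sub_le _ _).trans_lt (max_lt ?_ ?_)
    · rw [Polynomial.degree_mul, Polynomial.degree_mul]
      exact WithBot.add_lt_add_right (by simpa using hs) hpq
    · rw [Polynomial.degree_mul, Polynomial.degree_mul]
      exact WithBot.add_lt_add_left (by simpa using hq) hrs
  · rw [div_sub_div _ _ (aeval_ne_zero h hq) (aeval_ne_zero h hs)]
    simp

theorem IsCoeff.sub {t : Fin (n + 1) → K} {i : Fin (n + 1)}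
    (h : Transcendental (below C t i) (t i)) {a b : K}
    (ha : IsCoeff C t i a) (hb : IsCoeff C t i b) : IsCoeff C t i (a - b) := by
  rcases ha with ⟨h0, ha⟩ | ⟨h0, ha⟩ <;> rcases hb with ⟨h1, hb⟩ | ⟨h1, hb⟩
  · exact Or.inl ⟨h0, sub_mem ha hb⟩
  · exact absurd h0 h1.ne'
  · exact absurd h1 h0.ne'
  · exact Or.inr ⟨h0, ha.sub h hb⟩

theorem IsCoeff.of_zero {t : Fin (n + 1) → K} {i : Fin (n + 1)} : IsCoeff C t i (0 : K) := by
  rcases eq_or_ne i 0 with h | h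
  · exact Or.inl ⟨h, zero_mem _⟩
  · exact Or.inr ⟨Fin.pos_iff_ne_zero.2 h, .of_zero⟩

theorem below_mono (t : Fin (n + 1) → K) {i j : Fin (n + 1)} (h : i ≤ j) :
    below C t i ≤ below C t j :=
  IntermediateField.adjoin.mono _ _ _ (Set.image_mono fun _ hk => lt_of_lt_of_le hk h)

theorem upto_mono (t : Fin (n + 1) → K) {i j : Fin (n + 1)} (h : i ≤ j) :
    upto C t i ≤ upto C t j :=
  IntermediateField.adjoin.mono _ _ _ (Set.image_mono fun _ hk => le_trans hk h)

theorem below_le_upto (t : Fin (n + 1) → K) (i : Fin (n + 1)) : below C t i ≤ upto C t i :=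
  IntermediateField.adjoin.mono _ _ _ (Set.image_mono fun j (hk : j < i) => hk.le)

theorem upto_le_below (t : Fin (n + 1) → K) {i j : Fin (n + 1)} (h : i < j) :
    upto C t i ≤ below C t j :=
  IntermediateField.adjoin.mono _ _ _ (Set.image_mono fun _ hk => lt_of_le_of_lt hk h)

theorem below_succ (t : Fin (n + 1) → K) (i : Fin n) :
    below C t i.succ = upto C t i.castSucc := by
  unfold below upto
  congr 2
  ext j
  simp [Fin.lt_def, Fin.le_def]

theorem mem_upto_self (t : Fin (n + 1) → K) (i : Fin (n + 1)) : t i ∈ upto C t i :=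
  IntermediateField.subset_adjoin _ _ ⟨i, le_refl i, rfl⟩

theorem aeval_mem_upto (t : Fin (n + 1) → K) (i : Fin (n + 1)) (p : Polynomial (below C t i)) :
    Polynomial.aeval (t i) p ∈ upto C t i := by
  rw [Polynomial.aeval_eq_sum_range]
  refine sum_mem fun k _ => ?_
  rw [Algebra.smul_def]
  exact mul_mem (below_le_upto t i (p.coeff k).2) (pow_mem (mem_upto_self t i) _)

theorem IsCoeff.mem_upto {t : Fin (n + 1) → K} {i : Fin (n + 1)} {a : K}
    (ha : IsCoeff C t i a) : a ∈ upto C t i := by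
  rcases ha with ⟨rfl, ha⟩ | ⟨_, p, q, _, rfl⟩
  · exact ha
  · exact div_mem (aeval_mem_upto t i p) (aeval_mem_upto t i q)

theorem exists_div_of_mem_upto {t : Fin (n + 1) → K} {i : Fin (n + 1)} {f : K}
    (hf : f ∈ upto C t i) : ∃ p q : Polynomial (below C t i),
      f = Polynomial.aeval (t i) p / Polynomial.aeval (t i) q := by
  have h : upto C t i =
      (IntermediateField.adjoin (below C t i) {t i}).restrictScalars C := by
    unfold upto below
    rw [IntermediateField.adjoin_adjoin_left]
    congr 1
    ext y
    simp only [Set.mem_image, Set.mem_ofPred_eq, Set.union_singleton, Set.mem_insert_iff]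
    constructor
    · rintro ⟨j, hj, rfl⟩
      rcases hj.lt_or_eq with h | rfl
      · exact Or.inr ⟨j, h, rfl⟩
      · exact Or.inl rfl
    · rintro (rfl | ⟨j, hj, rfl⟩)
      · exact ⟨i, le_refl _, rfl⟩
      · exact ⟨j, hj.le, rfl⟩
  rw [h, IntermediateField.mem_restrictScalars, IntermediateField.mem_adjoin_simple_iff] at hf
  exact hf

theorem evalMon_sub (t : Fin (n + 1) → K) (c d : (Fin (n + 1) → ℕ) →₀ K) :
    evalMon t (c - d) = evalMon t c - evalMon t d :=
  Finsupp.sum_sub_index fun _ _ _ => sub_mul _ _ _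

theorem IsMatryoshka.sub {t : Fin (n + 1) → K} (h : ∀ i, Transcendental (below C t i) (t i))
    {c d : Fin (n + 1) → (Fin (n + 1) → ℕ) →₀ K} {f g : K}
    (hc : IsMatryoshka C t c f) (hd : IsMatryoshka C t d g) :
    IsMatryoshka C t (c - d) (f - g) where
  inT i e he := by
    by_contra hT
    apply he
    have h1 : c i e = 0 := by by_contra h1; exact hT (hc.inT i e h1)
    have h2 : d i e = 0 := by by_contra h1; exact hT (hd.inT i e h1)
    simp [h1, h2]
  isCoeff i e := by simpa using (hc.isCoeff i e).sub (h i) (hd.isCoeff i e)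
  sum_eq := by simp [evalMon_sub, ← hc.sum_eq, ← hd.sum_eq]

theorem isMatryoshka_zero (t : Fin (n + 1) → K) : IsMatryoshka C t 0 0 where
  inT i e he := by simp at he
  isCoeff i e := .of_zero
  sum_eq := by simp [evalMon]

/-- The elements with a decomposition form an additive group. -/
def decomposable (t : Fin (n + 1) → K) (h : ∀ i, Transcendental (below C t i) (t i)) :
    AddSubgroup K :=
  AddSubgroup.ofSub {f | ∃ c, IsMatryoshka C t c f} ⟨0, 0, isMatryoshka_zero t⟩ (by
    rintro x ⟨c, hc⟩ y ⟨d, hd⟩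
    simpa [sub_eq_add_neg] using (⟨c - d, hc.sub h hd⟩ : ∃ c, IsMatryoshka C t c (x - y)))

theorem mul_mon_mem (t : Fin (n + 1) → K) (h : ∀ i, Transcendental (below C t i) (t i))
    {i : Fin (n + 1)} {a : K} (ha : IsCoeff C t i a) {e : Fin (n + 1) → ℕ} (he : InT i e) :
    a * mon t e ∈ decomposable t h := by
  refine ⟨Pi.single i (Finsupp.single e a), ?_, ?_, ?_⟩
  · intro j e' hj
    rcases eq_or_ne j i with rfl | hji
    · rw [Pi.single_eq_same, Finsupp.single_apply] at hj
      split_ifs at hj with h1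
      · exact h1 ▸ he
      · simp at hj
    · simp [Pi.single_eq_of_ne hji] at hj
  · intro j e'
    rcases eq_or_ne j i with rfl | hji
    · rw [Pi.single_eq_same, Finsupp.single_apply]
      split_ifs
      · exact ha
      · exact .of_zero
    · rw [Pi.single_eq_of_ne hji]
      exact .of_zero
  · rw [Finset.sum_eq_single i]
    · simp [evalMon]
    · intro j _ hji
      simp [Pi.single_eq_of_ne hji, evalMon]
    · simp

theorem mon_add (t : Fin (n + 1) → K) (e e' : Fin (n + 1) → ℕ) :
    mon t (e + e') = mon t e * mon t e' := by
  simp [mon, pow_add, Finset.prod_mul_distrib]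

theorem mon_single (t : Fin (n + 1) → K) (i : Fin (n + 1)) (l : ℕ) :
    mon t (Pi.single i l) = t i ^ l := by
  unfold mon
  rw [Finset.prod_eq_single i]
  · simp
  · intro j _ hj
    simp [hj]
  · simp

theorem mon_zero (t : Fin (n + 1) → K) : mon t 0 = 1 := by simp [mon]

/-- Multiples of `f ∈ K_i` by monomials free of `t_1, …, t_i` can be decomposed. -/
theorem mem_decomposable (t : Fin (n + 1) → K) (h : ∀ i, Transcendental (below C t i) (t i))
    (i : Fin (n + 1)) : ∀ f ∈ upto C t i, ∀ e, InT i e → f * mon t e ∈ decomposable t h := by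
  induction i using Fin.induction with
  | zero => exact fun f hf e he => mul_mon_mem t h (Or.inl ⟨rfl, hf⟩) he
  | succ i ih =>
    intro f hf e he
    obtain ⟨p, q, rfl⟩ := exists_div_of_mem_upto hf
    rcases eq_or_ne q 0 with rfl | hq
    · simp [zero_mem]
    have hq' := aeval_ne_zero (h i.succ) hq
    have key : Polynomial.aeval (t i.succ) p / Polynomial.aeval (t i.succ) q =
        Polynomial.aeval (t i.succ) (p / q) +
          Polynomial.aeval (t i.succ) (p % q) / Polynomial.aeval (t i.succ) q := by
      rw [eq_comm, ← eq_sub_iff_add_eq, ← sub_div, ← map_sub, eq_div_iff hq', ← map_mul]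
      congr 1
      rw [eq_sub_iff_add_eq, mul_comm]
      exact EuclideanDomain.div_add_mod p q
    rw [key, add_mul]
    refine add_mem ?_ (mul_mon_mem t h (Or.inr ⟨Fin.succ_pos i, p % q, q, ?_, rfl⟩) he)
    · rw [Polynomial.aeval_eq_sum_range, Finset.sum_mul]
      refine sum_mem fun k _ => ?_
      have hmem : (((p / q).coeff k : below C t i.succ) : K) ∈ upto C t i.castSucc :=
        below_succ (C := C) t i ▸ ((p / q).coeff k).2
      have := ih _ hmem (Pi.single i.succ k + e) (by
        intro j hj
        have h1 : j < i.succ := lt_of_le_of_lt hj (Fin.castSucc_lt_succ)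
        simp [Pi.single_eq_of_ne h1.ne, he j h1.le])
      rw [mon_add, mon_single, ← mul_assoc] at this
      rwa [Algebra.smul_def]
    · exact EuclideanDomain.mod_lt p hq

theorem mon_mem_below (t : Fin (n + 1) → K) (i : Fin (n + 1)) (e : Fin (n + 1) → ℕ)
    (he : ∀ j, i ≤ j → e j = 0) : mon t e ∈ below C t i := by
  refine prod_mem fun j _ => ?_
  rcases le_or_gt i j with hj | hj
  · simp [he j hj, one_mem]
  · exact pow_mem (IntermediateField.subset_adjoin C _ (Set.mem_image_of_mem t hj)) _

theorem mon_update (t : Fin (n + 1) → K) (i : Fin (n + 1)) (e : Fin (n + 1) → ℕ) :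
    mon t e = mon t (Function.update e i 0) * t i ^ e i := by
  rw [← mon_single, ← mon_add]
  congr 1
  ext j
  rcases eq_or_ne j i with rfl | hj
  · simp
  · simp [hj]

/-- A decomposition of `0` that involves only `t_0, …, t_k` is trivial. -/
theorem eq_zero_of_isMatryoshka (t : Fin (n + 1) → K)
    (h : ∀ i, Transcendental (below C t i) (t i)) (k : Fin (n + 1)) :
    ∀ c, IsMatryoshka C t c 0 → (∀ i e, c i e ≠ 0 → i ≤ k ∧ ∀ j, k < j → e j = 0) → c = 0 := by
  induction k using Fin.induction with
  | zero =>
    intro c hc hs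
    have h1 : ∀ i e, c i e ≠ 0 → i = 0 ∧ e = 0 := by
      intro i e he
      have h0 := le_antisymm (hs i e he).1 (Fin.zero_le i)
      refine ⟨h0, funext fun j => ?_⟩
      rcases (Fin.zero_le j).lt_or_eq with hj | hj
      · exact (hs i e he).2 j hj
      · exact hc.inT i e he j (by rw [h0, ← hj])
    have h2 := hc.sum_eq
    rw [Finset.sum_eq_single 0] at h2
    · have h3 : evalMon t (c 0) = c 0 0 := by
        unfold evalMon Finsupp.sum
        rw [Finset.sum_eq_single 0]
        · simp [mon_zero]
        · intro e he h0
          exact absurd (h1 0 e (by simpa using he)).2 h0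
        · intro he
          simp [show c 0 0 = 0 by simpa using he]
      funext i
      ext e
      by_contra hne
      obtain ⟨rfl, rfl⟩ := h1 i e hne
      exact hne (by rw [← h3, ← h2]; rfl)
    · intro i _ hi
      have : c i = 0 := by
        ext e
        by_contra hne
        exact hi (h1 i e hne).1
      simp [this, evalMon]
    · simp
  | succ k ih =>
    intro c hc hs
    set s := k.succ with hsdef
    -- the component with index `s` is a single `t_s`-proper element
    have hlt : ∀ i, i < s → i ≤ k.castSucc := fun i hi => by
      rw [hsdef] at hi; exact Fin.le_castSucc_iff.2 hi
    have hmem : ∀ i e, i < s → c i e * mon t (Function.update e s 0) ∈ below C t s := by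
      intro i e hi
      by_cases hne : c i e = 0
      · simp [hne, zero_mem]
      refine mul_mem (upto_le_below t hi (hc.isCoeff i e).mem_upto) (mon_mem_below t s _ ?_)
      intro j hj
      rcases hj.lt_or_eq with hj | rfl
      · rw [Function.update_of_ne hj.ne']
        exact (hs i e hne).2 j hj
      · simp
    let w : Fin (n + 1) → (Fin (n + 1) → ℕ) → below C t s := fun i e =>
      if hi : i < s then ⟨c i e * mon t (Function.update e s 0), hmem i e hi⟩ else 0
    let P : Polynomial (below C t s) :=
      ∑ i with i < s, ∑ e ∈ (c i).support, Polynomial.monomial (e s) (w i e)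
    have hP : Polynomial.aeval (t s) P = ∑ i with i < s, evalMon t (c i) := by
      simp only [P, map_sum]
      refine Finset.sum_congr rfl fun i hi => ?_
      unfold evalMon Finsupp.sum
      refine Finset.sum_congr rfl fun e _ => ?_
      have hi' : i < s := by simpa using hi
      have hu := mon_update t s e
      rw [Polynomial.aeval_monomial]
      simp only [w, hi', dif_pos]
      rw [hu, ← mul_assoc]
      rfl
    have hsz : ∀ e, c s e ≠ 0 → e = 0 := fun e he => funext fun j => by
      rcases le_or_gt j s with hj | hj
      · exact hc.inT s e he j hj
      · exact (hs s e he).2 j hj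
    have hS : evalMon t (c s) = c s 0 := by
      unfold evalMon Finsupp.sum
      rw [Finset.sum_eq_single 0]
      · simp [mon_zero]
      · intro e he h0
        exact absurd (hsz e (by simpa using he)) h0
      · intro he
        simp [show c s 0 = 0 by simpa using he]
    have htot : Polynomial.aeval (t s) P + c s 0 = 0 := by
      rw [hP, ← hS, hc.sum_eq, ← Finset.sum_filter_add_sum_filter_not Finset.univ (· < s)]
      congr 1
      rw [Finset.sum_eq_single s]
      · intro i hi his
        have : c i = 0 := by
          ext e
          by_contra hne
          have h1 := (hs i e hne).1
          simp only [Finset.mem_filter, Finset.mem_univ, true_and, not_lt] at hi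
          exact his (le_antisymm h1 hi)
        simp [this, evalMon]
      · simp
    obtain ⟨p, q, hpq, hcs⟩ : IsProper C t s (c s 0) := by
      rcases hc.isCoeff s 0 with ⟨h0, _⟩ | ⟨_, h1⟩
      · exact absurd h0 (Fin.succ_ne_zero k)
      · exact h1
    have hq : q ≠ 0 := by rintro rfl; simp at hpq
    have hq' := aeval_ne_zero (h s) hq
    have hrel : P * q + p = 0 := by
      apply (transcendental_iff.1 (h s))
      rw [hcs] at htot
      field_simp at htot
      simpa using htot
    have hP0 : P = 0 := by
      by_contra hP0
      have h1 : p = -(P * q) := by rw [eq_neg_iff_add_eq_zero, add_comm]; exact hrel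
      rw [h1, Polynomial.degree_neg, Polynomial.degree_mul] at hpq
      have h2 : (0 : WithBot ℕ) ≤ P.degree := Polynomial.zero_le_degree_iff.2 hP0
      exact absurd hpq (not_lt.2 (le_add_of_nonneg_left h2))
    have hcs0 : c s 0 = 0 := by rw [hP0] at htot; simpa using htot
    -- the coefficients of powers of `t_s` are decompositions one level below
    have hlow : ∀ l i e, i < s → e s = l → c i e = 0 := by
      intro l
      let d : Fin (n + 1) → (Fin (n + 1) → ℕ) →₀ K := fun i =>
        if i < s then
          ((c i).filter fun e => e s = l).mapDomain fun e => Function.update e s 0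
        else 0
      have hinj : ∀ e : Fin (n + 1) → ℕ, e s = l →
          ∀ e' : Fin (n + 1) → ℕ, e' s = l →
            Function.update e s 0 = Function.update e' s 0 → e = e' := by
        intro e he e' he' hee
        funext j
        rcases eq_or_ne j s with rfl | hj
        · rw [he, he']
        · have := congrFun hee j
          simpa [Function.update_of_ne hj] using this
      have hInj : Set.InjOn (fun e : Fin (n + 1) → ℕ => Function.update e s 0)
          ({e | e s = l} : Set (Fin (n + 1) → ℕ)) := fun e he e' he' hee => hinj e he e' he' hee
      have hdval : ∀ i e, i < s → e s = l → d i (Function.update e s 0) = c i e := by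
        intro i e hi he
        simp only [d, hi, if_true]
        rw [Finsupp.mapDomain_apply' {e | e s = l} _ _ hInj he]
        · simp [he]
        · intro e' he'
          have h5 := Finset.mem_coe.1 he'
          simp only [Finsupp.support_filter, Finset.mem_filter] at h5
          exact h5.2
      have hdsupp : ∀ i e', d i e' ≠ 0 →
          i < s ∧ ∃ e, c i e ≠ 0 ∧ e s = l ∧ Function.update e s 0 = e' := by
        intro i e' hne
        by_cases hi : i < s
        · refine ⟨hi, ?_⟩
          simp only [d, hi, if_true] at hne
          have h1 := Finsupp.mapDomain_support (Finsupp.mem_support_iff.2 hne)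
          simp only [Finsupp.support_filter, Finset.mem_image, Finset.mem_filter,
            Finsupp.mem_support_iff] at h1
          obtain ⟨e, ⟨h2, h3⟩, h4⟩ := h1
          exact ⟨e, h2, h3, h4⟩
        · simp [d, hi] at hne
      have hd0 : d = 0 := by
        apply ih d
        · refine ⟨?_, ?_, ?_⟩
          · intro i e' hne j hj
            obtain ⟨hi, e, h1, _, rfl⟩ := hdsupp i e' hne
            rw [Function.update_of_ne (hj.trans_lt hi).ne]
            exact hc.inT i e h1 j hj
          · intro i e'
            by_cases hne : d i e' = 0
            · rw [hne]; exact .of_zero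
            · obtain ⟨hi, e, h1, h2, rfl⟩ := hdsupp i e' hne
              rw [hdval i e hi h2]
              exact hc.isCoeff i e
          · have h1 : ((P.coeff l : below C t s) : K) = ∑ i, evalMon t (d i) := by
              simp only [P, Polynomial.finsetSum_coeff, Polynomial.coeff_monomial]
              rw [Finset.sum_filter]
              push_cast
              refine Finset.sum_congr rfl fun i _ => ?_
              by_cases hi : i < s
              · simp only [hi, if_true, d, w, dif_pos]
                unfold evalMon
                rw [Finsupp.sum_mapDomain_index (by simp) (by intros; ring)]
                rw [Finsupp.sum, Finsupp.support_filter, Finset.sum_filter]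
                push_cast
                refine Finset.sum_congr rfl fun e _ => ?_
                split_ifs with h3
                · simp [h3]
                · rfl
              · simp [hi, d, evalMon]
            rw [← h1, hP0]
            simp
        · intro i e' hne
          obtain ⟨hi, e, h1, h2, rfl⟩ := hdsupp i e' hne
          refine ⟨hlt i hi, fun j hj => ?_⟩
          rcases eq_or_ne j s with rfl | hjs
          · simp
          · rw [Function.update_of_ne hjs]
            refine (hs i e h1).2 j (lt_of_le_of_ne ?_ hjs.symm)
            rw [Fin.lt_def, Fin.val_castSucc] at hj
            rw [hsdef, Fin.le_def, Fin.val_succ]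
            omega
      intro i e hi he
      rw [← hdval i e hi he, hd0]
      rfl
    funext i
    ext e
    by_contra hne
    rcases (hs i e hne).1.lt_or_eq with hi | hi
    · exact hne (hlow (e s) i e hi rfl)
    · have hne' : c s e ≠ 0 := hi ▸ hne
      exact hne' (by rw [hsz e hne']; exact hcs0)

/-- Every element of a primitive tower has exactly one matryoshka decomposition. -/
theorem existsUnique_matryoshka {D : Derivation C K K} {t : Fin (n + 1) → K}
    (ht : IsPrimitive D t) (f : K) : ∃! c, IsMatryoshka C t c f := by
  obtain ⟨c, hc⟩ : ∃ c, IsMatryoshka C t c f := by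
    have := mem_decomposable t ht.transcendental (Fin.last n) f (ht.top ▸ IntermediateField.mem_top)
      0 (fun _ _ => rfl)
    rw [mon_zero, mul_one] at this
    exact this
  refine ⟨c, hc, fun d hd => ?_⟩
  have h0 := hd.sub ht.transcendental hc
  rw [sub_self] at h0
  refine sub_eq_zero.1 (eq_zero_of_isMatryoshka t ht.transcendental (Fin.last n) _ h0 ?_)
  exact fun i e _ => ⟨Fin.le_last i, fun j hj => absurd hj (not_lt.2 (Fin.le_last j))⟩

/-- The coefficients of the matryoshka decomposition of `f` (in a primitive tower they exist and
are unique, see `existsUnique_matryoshka`). -/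
def coeffs (C : Type*) {K : Type*} [Field C] [Field K] [Algebra C K] {n : ℕ}
    (t : Fin (n + 1) → K) (f : K) : Fin (n + 1) → (Fin (n + 1) → ℕ) →₀ K :=
  if h : ∃ c, IsMatryoshka C t c f then h.choose else 0

/-- The `i`-th projection `π_i(f)`. -/
def proj (C : Type*) {K : Type*} [Field C] [Field K] [Algebra C K] {n : ℕ}
    (t : Fin (n + 1) → K) (i : Fin (n + 1)) (f : K) : K :=
  evalMon t (coeffs C t f i)

/-- Monomials with the purely lexicographic order in which `t_1 ≺ ⋯ ≺ t_n` (the exponent of `t_n`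
is compared first). -/
abbrev Mono (n : ℕ) : Type := Colex (Fin (n + 1) → ℕ)

/-- The `i`-th head monomial `hm_i(f)`; the zero "monomial" is `⊥`. -/
def hmAt (C : Type*) {K : Type*} [Field C] [Field K] [Algebra C K] {n : ℕ}
    (t : Fin (n + 1) → K) (i : Fin (n + 1)) (f : K) : WithBot (Mono n) :=
  ((coeffs C t f i).support.image toColex).max

/-- The `i`-th head coefficient `hc_i(f)`. -/
def hcAt (C : Type*) {K : Type*} [Field C] [Field K] [Algebra C K] {n : ℕ}
    (t : Fin (n + 1) → K) (i : Fin (n + 1)) (f : K) : K :=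
  WithBot.recBotCoe 0 (fun M : Mono n => coeffs C t f i (ofColex M)) (hmAt C t i f)

/-- The head monomial `hm(f)`. -/
def hm (C : Type*) {K : Type*} [Field C] [Field K] [Algebra C K] {n : ℕ}
    (t : Fin (n + 1) → K) (f : K) : WithBot (Mono n) :=
  Finset.univ.sup fun i => hmAt C t i f

/-- The head coefficient `hc(f)`: the sum of the `hc_i(f)` with `hm_i(f) = hm(f)`. -/
def hc (C : Type*) {K : Type*} [Field C] [Field K] [Algebra C K] {n : ℕ}
    (t : Fin (n + 1) → K) (f : K) : K :=
  ∑ i with hmAt C t i f = hm C t f, hcAt C t i f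

/-- The degree in `t_n` of the (reduced) denominator of `f ∈ K_n = K_{n-1}(t_n)`. The set below
has exactly one element when the tower is primitive. -/
def denDeg (C : Type*) {K : Type*} [Field C] [Field K] [Algebra C K] {n : ℕ}
    (t : Fin (n + 1) → K) (f : K) : ℕ :=
  sInf {d | ∃ p q : Polynomial (below C t (Fin.last n)), q ≠ 0 ∧ IsCoprime p q ∧
    f = Polynomial.aeval (t (Fin.last n)) p / Polynomial.aeval (t (Fin.last n)) q ∧
    q.natDegree = d}

/-- `f ≺ g`: the denominator degree in `t_n` is compared first, then the head monomial. -/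
def Lower (C : Type*) {K : Type*} [Field C] [Field K] [Algebra C K] {n : ℕ}
    (t : Fin (n + 1) → K) (f g : K) : Prop :=
  denDeg C t f < denDeg C t g ∨ (denDeg C t f = denDeg C t g ∧ hm C t f < hm C t g)

/-- `f ≡ g` modulo the integrable subspace `K_n'`. -/
def EqModDeriv (D : Derivation C K K) (f g : K) : Prop := ∃ u, f - g = D u

/-- `r` is a remainder of `f`: a `≺`-minimal element of the class of `f` modulo `K_n'`. -/
def IsRemainder (D : Derivation C K K) (t : Fin (n + 1) → K) (f r : K) : Prop :=
  EqModDeriv D r f ∧ ∀ s, EqModDeriv D s f → ¬ Lower C t s r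

/-- `f ∈ K_n` is simple: `π_i(f)` is `t_i`-simple for all `0 ≤ i ≤ n`. -/
def IsSimple (D : Derivation C K K) (t : Fin (n + 1) → K) (f : K) : Prop :=
  ∀ i, IsSimpleAt D t i (proj C t i f)

/-- An S-primitive tower: a primitive tower in which `t_1', …, t_n'` are simple. -/
structure IsSPrimitive (D : Derivation C K K) (t : Fin (n + 1) → K) : Prop
    extends IsPrimitive D t where
  simple : ∀ i, 0 < i → IsSimple D t (D (t i))

/-- The indicator of a monomial: the least `j` whose exponent is nonzero, and `n` for the monomial
`1` (`n` is the top element of `Fin (n + 1)`, that is, the infimum of the empty set). -/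
def ind (M : Mono n) : Fin (n + 1) := (Finset.univ.filter fun j => M j ≠ 0).inf id

/-- `span_C {t_1', …, t_m'}`. -/
def derivSpan (D : Derivation C K K) (t : Fin (n + 1) → K) (m : Fin (n + 1)) : Submodule C K :=
  Submodule.span C {y | ∃ j, 0 < j ∧ j ≤ m ∧ y = D (t j)}

/-- `f - π_n(f)`. -/
def rest (C : Type*) {K : Type*} [Field C] [Field K] [Algebra C K] {n : ℕ}
    (t : Fin (n + 1) → K) (f : K) : K :=
  f - proj C t (Fin.last n) f

/-- The explicit form of a remainder: `r = 0`, or `π_n(r)` is `t_n`-simple and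
`hc(r - π_n(r))` is simple and not a nonzero element of `span_C {t_1', …, t_m'}`, where `m` is the
indicator of `hm(r)`. -/
def HasRemainderForm (D : Derivation C K K) (t : Fin (n + 1) → K) (r : K) : Prop :=
  r = 0 ∨ ∃ M : Mono n, hm C t r = M ∧
    IsSimpleAt D t (Fin.last n) (proj C t (Fin.last n) r) ∧
    IsSimple D t (hc C t (rest C t r)) ∧
    ¬ (hc C t (rest C t r) ≠ 0 ∧ hc C t (rest C t r) ∈ derivSpan D t (ind M))

/-- Hermite reduction `a = b' + h` of a coefficient `a` of `P_i` in `K_i`: here `b` is again a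
coefficient of `P_i`, and `h` is `t_i`-simple. -/
def IsHermite (D : Derivation C K K) (t : Fin (n + 1) → K) (i : Fin (n + 1)) (a b h : K) : Prop :=
  IsCoeff C t i b ∧ IsSimpleAt D t i h ∧ a = D b + h

/-- One step of the construction. A state `(g, r)` stands for the decomposition `g' + r`; a step
moves the derivative of an explicit element from `r` to `g`.
* `hermite`: Hermite reduction of `π_n(r)`, if this is not `t_n`-simple.
* `head`: let `a M` be the head term of `r - π_n(r)`, where `a` is not simple, and `m = ind M`.
  Reduce `π_i(a) = b_i' + h_i` for all `i < m`, and integrate `(∑ b_i)' M` by parts.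
* `span`: let `a M` be the head term of `r - π_n(r)`, where `a = ∑_{1 ≤ j ≤ m} c_j t_j'` with
  `c_j ∈ C` and `m = ind M`. Integrate `(∑_{1 ≤ j < m} c_j t_j)' M` and `c_m t_m' M` by parts. -/
inductive Step (D : Derivation C K K) (t : Fin (n + 1) → K) : K × K → K × K → Prop
  | hermite (g r b h : K)
      (hn : ¬ IsSimpleAt D t (Fin.last n) (proj C t (Fin.last n) r))
      (hb : IsHermite D t (Fin.last n) (proj C t (Fin.last n) r) b h) :
      Step D t (g, r) (g + b, r - D b)
  | head (g r : K) (M : Mono n) (b h : Fin (n + 1) → K)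
      (hM : hm C t (rest C t r) = M)
      (hn : ¬ IsSimple D t (hc C t (rest C t r)))
      (hb : ∀ i, i < ind M → IsHermite D t i (proj C t i (hc C t (rest C t r))) (b i) (h i))
      (u : K) (hu : u = (∑ i with i < ind M, b i) * mon t (ofColex M)) :
      Step D t (g, r) (g + u, r - D u)
  | span (g r : K) (M : Mono n) (c : Fin (n + 1) → C)
      (hM : hm C t (rest C t r) = M)
      (ha : hc C t (rest C t r) = ∑ j with 0 < j ∧ j ≤ ind M, c j • D (t j))
      (u : K) (hu : u = (∑ j with 0 < j ∧ j < ind M, c j • t j) * mon t (ofColex M) +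
        (c (ind M) / ((M (ind M) : C) + 1)) • (t (ind M) * mon t (ofColex M))) :
      Step D t (g, r) (g + u, r - D u)

/-- The construction has come to an end: no step applies. -/
def Done (D : Derivation C K K) (t : Fin (n + 1) → K) (s : K × K) : Prop :=
  ∀ s', ¬ Step D t s s'

end PrimitiveTower

end

/-!
Each field `K_i = K_{i-1}(t_i)` is treated as a field of fractions of polynomials in `t_i`, on
which `D` induces the derivation `polyDeriv`. Since `K_i` has no constants outside of `K_{i-1}`,
every irreducible polynomial is coprime to its derivative (`not_dvd_polyDeriv`). Hence simple
means proper with squarefree denominator (`isSimpleAt_iff`), so the simple elements form a vector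
space, and every pole of a derivative is multiple (`sq_dvd_denominator`). So a simple derivative
is zero (`deriv_eq_zero_of_simple`), adding a derivative to a simple element never lowers the
degree of the denominator (`exists_poly_of_denDeg_le`), and coefficients have Hermite reductions
(`IsCoeff.exists_hermite`).

The decomposition of `f` is recorded by `totalCoeff ht M f`, the sum of the coefficients of the
monomial `M` in all components. If `a` can be a coefficient of `M`, then `(a M)' = a' M` up to
lower monomials (`deriv_flat_mul_mon`). If `c` is constant, then the head term of `(c M)'` is `c d
t_m' M / t_m`, where `m = ind M` and `d` is the exponent of `t_m` in `M`, as `t_m'` is simple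
(`deriv_smul_mon`).

The main point is `mem_derivSpan_of_isSimple`: if `M` is the highest monomial of `u'` and its
coefficient `a` is simple, then `a` is a linear combination of `t_1', …, t_m'` with `m = ind M`.
To see this, let `Q` run through the monomials of `u` above `M` from the top down. The coefficient
of `Q` in `u'` is zero and turns out to be the derivative of `b + ∑ c_k t_k`, where `b` is the
coefficient of `Q` in `u` and the sum comes from those higher monomials whose derivative involves
`Q`. Such an element is a constant only if `b` is constant and the sum is empty. So all these
coefficients are constants, and `Q / t_{ind Q} ≤ M`, for otherwise `Q` would contribute to the
coefficient of `Q / t_{ind Q}` in `u'` (`constantAbove_of_totalCoeff_deriv`). Consequently `a` is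
the derivative of such an element `b + ∑ c_k t_k` too. Here `b'` is simple, hence zero, and `a = ∑
c_k t_k'`.

It follows that an element in remainder form is minimal (`not_lower_of_hasRemainderForm`). A step
makes `π_n(r)` simple, or lowers the head monomial of `r - π_n(r)`, or keeps that monomial and
makes its coefficient simple; so sequences of steps are finite (`stepMeasure_lt`). As Hermite
reductions exist, a state to which no step applies is in remainder form (`Done.hasRemainderForm`).
-/

noncomputable section

namespace PrimitiveTower

section Poles

open Polynomial

/-! ### Denominators and derivations of polynomial rings -/

section Polynomial

variable {F : Type*} [Field F]

theorem squarefree_of_isCoprime_derivation (δ : Derivation ℤ F[X] F[X]) {q : F[X]}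
    (h : IsCoprime q (δ q)) : Squarefree q := by
  rintro x ⟨y, rfl⟩
  refine h.isUnit_of_dvd' ⟨x * y, by ring⟩ ?_
  rw [mul_assoc, Derivation.leibniz]
  simp only [smul_eq_mul, Derivation.leibniz]
  exact ⟨(x * δ y + y * δ x) + y * δ x, by ring⟩

theorem isCoprime_derivation_of_squarefree (δ : Derivation ℤ F[X] F[X])
    (hδ : ∀ π : F[X], Irreducible π → ¬ π ∣ δ π) {q : F[X]} (hq : Squarefree q) :
    IsCoprime q (δ q) := by
  refine isCoprime_of_irreducible_dvd (fun h => hq.ne_zero h.1) ?_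
  rintro π hπ ⟨y, rfl⟩ hd
  rw [Derivation.leibniz, smul_eq_mul, smul_eq_mul, dvd_add_right (dvd_mul_right _ _)] at hd
  have hy := (hπ.prime.dvd_or_dvd hd).resolve_right (hδ π hπ)
  exact hπ.not_isUnit (hq π (mul_dvd_mul_left π hy))

theorem dvd_of_squarefree {q S : F[X]} (hq : Squarefree q)
    (h : ∀ π, Irreducible π → π ∣ q → π ∣ S) : q ∣ S := by
  obtain ⟨y, hy⟩ := EuclideanDomain.gcd_dvd_left q S
  by_cases hu : IsUnit y
  · exact (hu.dvd_mul_right.1 hy.dvd).trans (EuclideanDomain.gcd_dvd_right q S)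
  have hy0 : y ≠ 0 := by
    rintro rfl
    exact hq.ne_zero (by simpa using hy)
  obtain ⟨π, hπ, hd⟩ := WfDvdMonoid.exists_irreducible_factor hu hy0
  have h1 : π ∣ q := hd.trans ⟨_, by rw [mul_comm]; exact hy⟩
  have h2 := EuclideanDomain.dvd_gcd h1 (h π hπ h1)
  exact absurd (hq π (by rw [hy]; exact mul_dvd_mul h2 hd)) hπ.not_isUnit

/-- A pole of `A / B` becomes a pole of order at least two of its derivative, and adding a fraction
`p / q` with squarefree `q` leaves a pole of order at least two in `N / S = p / q + (A / B)'`. -/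
theorem sq_dvd_denominator [CharZero F] (δ : Derivation ℤ F[X] F[X])
    (hδ : ∀ π : F[X], Irreducible π → ¬ π ∣ δ π) {p q A B N S π : F[X]} (hπ : Irreducible π)
    (hB0 : B ≠ 0) (hAB : IsCoprime A B) (hq : Squarefree q) (hB : π ∣ B)
    (h : (p * B ^ 2 + q * (δ A * B - A * δ B)) * S = N * q * B ^ 2) : π ^ 2 ∣ S := by
  have hp := hπ.prime
  have hfin : FiniteMultiplicity π B := FiniteMultiplicity.of_not_isUnit hπ.not_isUnit hB0
  obtain ⟨E, hE, hEd⟩ := hfin.exists_eq_pow_mul_and_not_dvd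
  have hA : ¬ π ∣ A := fun hA => hπ.not_isUnit (hAB.isUnit_of_dvd' hA hB)
  obtain ⟨k, hk⟩ : ∃ k, multiplicity π B = k + 1 :=
    ⟨multiplicity π B - 1, by
      have : multiplicity π B ≠ 0 := fun h0 => multiplicity_ne_zero.2 hB h0
      omega⟩
  rw [hk] at hE
  obtain ⟨G, hG, hGd⟩ : ∃ G, δ A * B - A * δ B = π ^ k * G ∧ ¬ π ∣ G := by
    refine ⟨π * (δ A * E - A * δ E) - ((k + 1 : ℕ) : F[X]) * A * E * δ π, ?_, ?_⟩
    · rw [hE, Derivation.leibniz, Derivation.leibniz_pow]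
      simp only [smul_eq_mul, nsmul_eq_mul, Nat.add_sub_cancel]
      ring
    · rw [dvd_sub_right (dvd_mul_right _ _)]
      intro hd
      rcases hp.dvd_or_dvd hd with hd | hd
      · rcases hp.dvd_or_dvd hd with hd | hd
        · rcases hp.dvd_or_dvd hd with hd | hd
          · refine hπ.not_isUnit (isUnit_of_dvd_unit hd ?_)
            rw [← map_natCast (C : F →+* F[X])]
            exact isUnit_C.2 (isUnit_iff_ne_zero.2 (by exact_mod_cast Nat.succ_ne_zero k))
          · exact hA hd
        · exact hEd hd
      · exact hδ π hπ hd
  have hπ0 : π ^ k ≠ 0 := pow_ne_zero _ hπ.ne_zero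
  have h1 : (p * π ^ (k + 2) * E ^ 2 + q * G) * S = N * q * π ^ (k + 2) * E ^ 2 := by
    apply mul_left_cancel₀ hπ0
    rw [hG, hE] at h
    linear_combination h
  by_cases hqd : π ∣ q
  · obtain ⟨q', rfl⟩ := hqd
    have hq' : ¬ π ∣ q' := fun hd => hπ.not_isUnit (hq π (mul_dvd_mul_left π hd))
    have h2 : (p * π ^ (k + 1) * E ^ 2 + q' * G) * S = N * q' * π ^ (k + 2) * E ^ 2 := by
      apply mul_left_cancel₀ hπ.ne_zero
      linear_combination h1
    refine hp.pow_dvd_of_dvd_mul_left 2 (a := p * π ^ (k + 1) * E ^ 2 + q' * G) ?_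
      ⟨N * q' * π ^ k * E ^ 2, by rw [h2]; ring⟩
    rw [dvd_add_right ⟨p * π ^ k * E ^ 2, by ring⟩]
    exact fun hd => (hp.dvd_or_dvd hd).elim hq' hGd
  · refine hp.pow_dvd_of_dvd_mul_left 2 (a := p * π ^ (k + 2) * E ^ 2 + q * G) ?_
      ⟨N * q * π ^ k * E ^ 2, by rw [h1]; ring⟩
    rw [dvd_add_right ⟨p * π ^ (k + 1) * E ^ 2, by ring⟩]
    exact fun hd => (hp.dvd_or_dvd hd).elim hqd hGd

/-- If `N / S = p / q + (A / B)'` with squarefree `q`, then all poles of `p / q` are poles of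
`N / S`. -/
theorem squarefree_dvd_denominator [CharZero F] (δ : Derivation ℤ F[X] F[X])
    (hδ : ∀ π : F[X], Irreducible π → ¬ π ∣ δ π) {p q A B N S : F[X]}
    (hB0 : B ≠ 0) (hAB : IsCoprime A B) (hpq : IsCoprime p q) (hq : Squarefree q)
    (h : (p * B ^ 2 + q * (δ A * B - A * δ B)) * S = N * q * B ^ 2) : q ∣ S := by
  refine dvd_of_squarefree hq fun π hπ hd => ?_
  by_cases hB : π ∣ B
  · exact (dvd_pow_self π two_ne_zero).trans (sq_dvd_denominator δ hδ hπ hB0 hAB hq hB h)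
  have hp := hπ.prime
  have h1 : π ∣ (p * B ^ 2 + q * (δ A * B - A * δ B)) * S := by
    rw [h]
    exact (hd.mul_left N).mul_right _
  refine (hp.dvd_or_dvd h1).resolve_left ?_
  rw [dvd_add_left (hd.mul_right _)]
  intro hd'
  rcases hp.dvd_or_dvd hd' with hd' | hd'
  · exact hπ.not_isUnit (hpq.isUnit_of_dvd' hd' hd)
  · exact hB (hp.dvd_of_dvd_pow hd')

/-- Adding a derivative to a fraction with squarefree denominator does not lower the degree of the
denominator, unless that derivative is the derivative of a polynomial. -/
theorem isUnit_of_natDegree_le [CharZero F] (δ : Derivation ℤ F[X] F[X])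
    (hδ : ∀ π : F[X], Irreducible π → ¬ π ∣ δ π) {p q A B N S : F[X]}
    (hB0 : B ≠ 0) (hAB : IsCoprime A B) (hpq : IsCoprime p q) (hq : Squarefree q) (hS : S ≠ 0)
    (hdeg : S.natDegree ≤ q.natDegree)
    (h : (p * B ^ 2 + q * (δ A * B - A * δ B)) * S = N * q * B ^ 2) : IsUnit B := by
  by_contra hu
  obtain ⟨π, hπ, hd⟩ := WfDvdMonoid.exists_irreducible_factor hu hB0
  have h1 := sq_dvd_denominator δ hδ hπ hB0 hAB hq hd h
  have h2 := squarefree_dvd_denominator δ hδ hB0 hAB hpq hq h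
  have h3 : S ∣ q := (associated_of_dvd_of_natDegree_le h2 hS hdeg).symm.dvd
  exact hπ.not_isUnit (hq π (by rw [← sq]; exact h1.trans h3))

/-- If `N / S = (A / B)'` with squarefree `S`, then `A / B` is a polynomial. -/
theorem isUnit_of_squarefree [CharZero F] (δ : Derivation ℤ F[X] F[X])
    (hδ : ∀ π : F[X], Irreducible π → ¬ π ∣ δ π) {A B N S : F[X]}
    (hB0 : B ≠ 0) (hAB : IsCoprime A B) (hS : Squarefree S)
    (h : (δ A * B - A * δ B) * S = N * B ^ 2) : IsUnit B := by
  by_contra hu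
  obtain ⟨π, hπ, hd⟩ := WfDvdMonoid.exists_irreducible_factor hu hB0
  have h1 := sq_dvd_denominator (p := 0) (q := 1) (N := N) (S := S) δ hδ hπ hB0 hAB
    squarefree_one hd (by linear_combination h)
  exact hπ.not_isUnit (hS π (by rw [← sq]; exact h1))

/-- The common denominator of two fractions with squarefree denominators can be chosen
squarefree. -/
theorem exists_squarefree_common {q₁ q₂ : F[X]} (h₁ : Squarefree q₁) (h₂ : Squarefree q₂) :
    ∃ L, Squarefree L ∧ q₁ ∣ L ∧ q₂ ∣ L := by
  obtain ⟨a, ha⟩ := EuclideanDomain.gcd_dvd_left q₁ q₂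
  obtain ⟨b, hb⟩ := EuclideanDomain.gcd_dvd_right q₁ q₂
  refine ⟨q₁ * b, ?_, dvd_mul_right _ _, ?_⟩
  · have hbd : b ∣ q₂ := ⟨_, by rw [mul_comm]; exact hb⟩
    refine squarefree_mul_iff.2 ⟨IsCoprime.isRelPrime ?_, h₁, h₂.squarefree_of_dvd hbd⟩
    refine isCoprime_of_irreducible_dvd (fun h => h₁.ne_zero h.1) fun π hπ hd hd' => ?_
    have := EuclideanDomain.dvd_gcd hd (hd'.trans hbd)
    exact hπ.not_isUnit (h₂ π (by rw [hb]; exact mul_dvd_mul this hd'))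
  · exact hb.dvd.trans (mul_dvd_mul_right ⟨a, ha⟩ b)

/-- One step of Hermite reduction: for a denominator `π ^ (k + 2) * E` the numerator is changed
modulo `π` to lower the order of the pole at `π`. -/
theorem exists_hermite_numerator [CharZero F] (δ : Derivation ℤ F[X] F[X])
    (hδ : ∀ π : F[X], Irreducible π → ¬ π ∣ δ π) {π E : F[X]} (hπ : Irreducible π)
    (hE : ¬ π ∣ E) (A : F[X]) (k : ℕ) :
    ∃ c : F[X], c.degree < π.degree ∧ π ∣ A + ((k + 1 : ℕ) : F[X]) * c * δ π * E := by
  have hcop : IsCoprime π (((k + 1 : ℕ) : F[X]) * δ π * E) := by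
    refine (hπ.isCoprime_or_dvd _).resolve_right fun hd => ?_
    rcases hπ.prime.dvd_or_dvd hd with hd | hd
    · rcases hπ.prime.dvd_or_dvd hd with hd | hd
      · refine hπ.not_isUnit (isUnit_of_dvd_unit hd ?_)
        rw [← map_natCast (C : F →+* F[X])]
        exact isUnit_C.2 (isUnit_iff_ne_zero.2 (by exact_mod_cast Nat.succ_ne_zero k))
      · exact hδ π hπ hd
    · exact hE hd
  obtain ⟨x, y, hxy⟩ := hcop
  refine ⟨(-A * y) % π, EuclideanDomain.mod_lt _ hπ.ne_zero, ?_⟩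
  have h1 := EuclideanDomain.div_add_mod (-A * y) π
  refine ⟨A * x - ((k + 1 : ℕ) : F[X]) * δ π * E * ((-A * y) / π), ?_⟩
  linear_combination (-A) * hxy + ((k + 1 : ℕ) : F[X]) * δ π * E * h1

end Polynomial

/-! ### The derivation on one level of the tower -/

section Level

variable {C K : Type*} [Field C] [Field K] [Algebra C K] {n : ℕ}
  {D : Derivation C K K} {t : Fin (n + 1) → K}

theorem IsPrimitive.deriv_gen_mem (ht : IsPrimitive D t) (i : Fin (n + 1)) :
    D (t i) ∈ below C t i := by
  rcases eq_or_ne i 0 with rfl | h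
  · rw [ht.deriv_x]
    exact one_mem _
  · exact ht.deriv_mem i (Fin.pos_iff_ne_zero.2 h)

theorem IsPrimitive.deriv_mem_adjoin (ht : IsPrimitive D t) {s : Set (Fin (n + 1))}
    (hs : ∀ i ∈ s, ∀ j < i, j ∈ s) {f : K} (hf : f ∈ IntermediateField.adjoin C (t '' s)) :
    D f ∈ IntermediateField.adjoin C (t '' s) := by
  induction hf using IntermediateField.adjoin_induction with
  | mem x hx =>
    obtain ⟨i, hi, rfl⟩ := hx
    refine IntermediateField.adjoin.mono _ _ _ (Set.image_mono ?_) (ht.deriv_gen_mem i)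
    exact fun j hj => hs i hi j hj
  | algebraMap c => simp [zero_mem]
  | add x y _ _ hx hy => rw [map_add]; exact add_mem hx hy
  | inv x hx h =>
    rw [Derivation.leibniz_inv]
    exact mul_mem (neg_mem (pow_mem (inv_mem hx) 2)) h
  | mul x y hx hy h1 h2 =>
    rw [Derivation.leibniz]
    exact add_mem (mul_mem hx h2) (mul_mem hy h1)

theorem IsPrimitive.deriv_mem_below (ht : IsPrimitive D t) {i : Fin (n + 1)} {f : K}
    (hf : f ∈ below C t i) : D f ∈ below C t i :=
  ht.deriv_mem_adjoin (fun _ hi _ hj => lt_trans hj hi) hf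

theorem IsPrimitive.deriv_mem_upto (ht : IsPrimitive D t) {i : Fin (n + 1)} {f : K}
    (hf : f ∈ upto C t i) : D f ∈ upto C t i :=
  ht.deriv_mem_adjoin (fun _ hi _ hj => hj.le.trans hi) hf

theorem IsPrimitive.aeval_injective (ht : IsPrimitive D t) (i : Fin (n + 1)) :
    Function.Injective (aeval (R := below C t i) (t i)) :=
  transcendental_iff_injective.1 (ht.transcendental i)

theorem IsPrimitive.exists_polyDeriv (ht : IsPrimitive D t) (i : Fin (n + 1))
    (p : (below C t i)[X]) : ∃ e : (below C t i)[X], aeval (t i) e = D (aeval (t i) p) ∧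
      e.degree ≤ p.degree := by
  let a : ℕ → below C t i := fun k => ⟨D (p.coeff k), ht.deriv_mem_below (p.coeff k).2⟩
  let d : below C t i := ⟨D (t i), ht.deriv_gen_mem i⟩
  have hd : ((d : below C t i) : K) = D (t i) := rfl
  rcases eq_or_ne p 0 with rfl | hp
  · exact ⟨0, by simp, le_rfl⟩
  refine ⟨∑ k ∈ Finset.range (p.natDegree + 1),
    (Polynomial.C (a k) * X ^ k + Polynomial.C (p.coeff k * k * d) * X ^ (k - 1)), ?_, ?_⟩
  · conv_rhs => rw [p.aeval_eq_sum_range]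
    rw [map_sum, map_sum]
    refine Finset.sum_congr rfl fun k _ => ?_
    rw [Algebra.smul_def, Derivation.leibniz, Derivation.leibniz_pow]
    simp only [map_add, map_mul, aeval_C, map_pow, aeval_X, smul_eq_mul, nsmul_eq_mul,
      IntermediateField.algebraMap_apply, hd, a, map_natCast]
    ring
  · rw [degree_eq_natDegree hp]
    refine degree_le_of_natDegree_le (natDegree_sum_le_of_forall_le _ _ fun k hk => ?_)
    have hk' := Finset.mem_range_succ_iff.1 hk
    refine natDegree_add_le_of_degree_le ?_ ?_
    · exact (natDegree_C_mul_X_pow_le _ _).trans hk'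
    · exact (natDegree_C_mul_X_pow_le _ _).trans ((Nat.sub_le _ _).trans hk')

/-- The value of `polyDeriv` at a polynomial. -/
def polyDerivFun (ht : IsPrimitive D t) (i : Fin (n + 1)) (p : (below C t i)[X]) :
    (below C t i)[X] :=
  (ht.exists_polyDeriv i p).choose

theorem aeval_polyDerivFun (ht : IsPrimitive D t) (i : Fin (n + 1)) (p : (below C t i)[X]) :
    aeval (t i) (polyDerivFun ht i p) = D (aeval (t i) p) :=
  (ht.exists_polyDeriv i p).choose_spec.1

/-- The derivation of the polynomial ring `K_{i-1}[X]` that `D` induces via `X ↦ t_i`. -/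
def polyDeriv (ht : IsPrimitive D t) (i : Fin (n + 1)) :
    Derivation ℤ (below C t i)[X] (below C t i)[X] :=
  Derivation.mk'
    (AddMonoidHom.toIntLinearMap
      { toFun := polyDerivFun ht i
        map_zero' := ht.aeval_injective i (by simp [aeval_polyDerivFun])
        map_add' := fun p q => ht.aeval_injective i (by simp [aeval_polyDerivFun]) })
    fun p q => ht.aeval_injective i (by
      change aeval (t i) (polyDerivFun ht i (p * q)) =
        aeval (t i) (p * polyDerivFun ht i q + q * polyDerivFun ht i p)
      simp [aeval_polyDerivFun])

variable (ht : IsPrimitive D t) {i : Fin (n + 1)}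

theorem aeval_polyDeriv (p : (below C t i)[X]) :
    aeval (t i) (polyDeriv ht i p) = D (aeval (t i) p) :=
  (ht.exists_polyDeriv i p).choose_spec.1

theorem degree_polyDeriv_le (p : (below C t i)[X]) : (polyDeriv ht i p).degree ≤ p.degree :=
  (ht.exists_polyDeriv i p).choose_spec.2

theorem polyDeriv_X : polyDeriv ht i X = Polynomial.C ⟨D (t i), ht.deriv_gen_mem i⟩ :=
  ht.aeval_injective i (by rw [aeval_polyDeriv, aeval_X, aeval_C]; rfl)

theorem mem_bot_of_mem_below_zero {f : K} (hf : f ∈ below C t 0) :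
    f ∈ (⊥ : IntermediateField C K) := by
  have : t '' {j | j < 0} = ∅ := by
    rw [Set.image_eq_empty]
    exact Set.eq_empty_of_forall_notMem fun j hj => absurd hj (Fin.not_lt_zero j)
  rwa [below, this, IntermediateField.adjoin_empty] at hf

theorem deriv_eq_zero_of_mem_bot {f : K} (hf : f ∈ (⊥ : IntermediateField C K)) : D f = 0 := by
  obtain ⟨c, rfl⟩ := IntermediateField.mem_bot.1 hf
  exact D.map_algebraMap c

/-- Over `C(x)` the derivation on polynomials in `x` is the usual one. -/
theorem polyDeriv_zero_level (p : (below C t 0)[X]) : polyDeriv ht 0 p = derivative p := by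
  have hX : polyDeriv ht 0 X = 1 := by
    rw [polyDeriv_X, ← map_one (Polynomial.C : below C t 0 →+* _)]
    congr 1
    exact Subtype.ext ht.deriv_x
  have hC : ∀ a : below C t 0, polyDeriv ht 0 (Polynomial.C a) = 0 := fun a => by
    apply ht.aeval_injective 0
    rw [aeval_polyDeriv, aeval_C, map_zero]
    exact deriv_eq_zero_of_mem_bot (mem_bot_of_mem_below_zero a.2)
  induction p using Polynomial.induction_on' with
  | add p q hp hq => rw [map_add, map_add, hp, hq]
  | monomial k a =>
    rw [← C_mul_X_pow_eq_monomial, Derivation.leibniz, Derivation.leibniz_pow, hX, hC,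
      derivative_C_mul_X_pow]
    simp [mul_assoc]

theorem charZero_below (C : Type*) {K : Type*} [Field C] [Field K] [Algebra C K] [CharZero C]
    {n : ℕ} (t : Fin (n + 1) → K) (i : Fin (n + 1)) : CharZero (below C t i) :=
  charZero_of_injective_algebraMap (algebraMap C (below C t i)).injective

/-- A polynomial of positive degree in `t_i` is not a constant of the derivation. -/
theorem deriv_aeval_ne_zero [CharZero C] (ht : IsPrimitive D t) {p : (below C t i)[X]}
    (hdeg : 0 < p.natDegree) :
    D (aeval (t i) p) ≠ 0 := by
  intro h0
  rcases eq_or_ne i 0 with rfl | hi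
  · have := charZero_below C t 0
    rw [← aeval_polyDeriv ht, polyDeriv_zero_level ht] at h0
    have h1 := (transcendental_iff.1 (ht.transcendental 0)) _ h0
    exact hdeg.ne' (derivative_eq_zero.1 h1)
  · have h1 := ht.constants i (Fin.pos_iff_ne_zero.2 hi) _ (aeval_mem_upto t i p) h0
    have h2 : p = Polynomial.C ⟨_, h1⟩ := ht.aeval_injective i (by rw [aeval_C]; rfl)
    rw [h2, natDegree_C] at hdeg
    exact hdeg.false

theorem degree_polyDeriv_lt {p : (below C t i)[X]} (hp : p.Monic) (hdeg : 0 < p.natDegree) :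
    (polyDeriv ht i p).degree < p.degree := by
  have h1 : p = X ^ p.natDegree + (p - X ^ p.natDegree) := by ring
  have h2 : (polyDeriv ht i (p - X ^ p.natDegree)).degree < p.degree := by
    refine (degree_polyDeriv_le ht _).trans_lt (degree_sub_lt_left ?_ hp.ne_zero ?_)
    · rw [degree_X_pow, degree_eq_natDegree hp.ne_zero]
    · rw [hp.leadingCoeff, leadingCoeff_X_pow]
  conv_lhs => rw [h1]
  rw [map_add]
  refine (degree_add_le _ _).trans_lt (max_lt ?_ h2)
  rw [Derivation.leibniz_pow, polyDeriv_X, degree_eq_natDegree hp.ne_zero, smul_eq_mul,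
    nsmul_eq_mul, ← map_natCast (Polynomial.C : below C t i →+* _), mul_left_comm, mul_comm,
    ← map_mul]
  refine (degree_C_mul_X_pow_le _ _).trans_lt ?_
  exact_mod_cast Nat.sub_lt hdeg one_pos

/-- In a primitive tower all irreducible polynomials are normal. -/
theorem not_dvd_polyDeriv [CharZero C] {π : (below C t i)[X]} (hπ : Irreducible π) :
    ¬ π ∣ polyDeriv ht i π := by
  intro hd
  have hl : π.leadingCoeff⁻¹ ≠ 0 := inv_ne_zero (leadingCoeff_ne_zero.2 hπ.ne_zero)
  set p := π * Polynomial.C π.leadingCoeff⁻¹ with hp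
  have hm : p.Monic := monic_mul_leadingCoeff_inv hπ.ne_zero
  have hn : p.natDegree = π.natDegree := natDegree_mul_C hl
  have hpos : 0 < p.natDegree := hn ▸ hπ.natDegree_pos
  have h1 : π ∣ polyDeriv ht i p := by
    rw [hp, Derivation.leibniz]
    exact dvd_add (dvd_mul_right _ _) (hd.mul_left _)
  have h2 : polyDeriv ht i p = 0 := by
    refine eq_zero_of_dvd_of_degree_lt h1 ((degree_polyDeriv_lt ht hm hpos).trans_le ?_)
    rw [hp, degree_mul_C hl]
  refine deriv_aeval_ne_zero ht hpos ?_
  rw [← aeval_polyDeriv ht, h2, map_zero]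

end Level

/-! ### Proper and simple elements, Hermite reduction -/

section Simple

variable {C K : Type*} [Field C] [Field K] [Algebra C K] {n : ℕ}
  {D : Derivation C K K} {t : Fin (n + 1) → K} {i : Fin (n + 1)}

theorem IsProper.mem_upto {f : K} (hf : IsProper C t i f) : f ∈ upto C t i := by
  obtain ⟨p, q, _, rfl⟩ := hf
  exact div_mem (aeval_mem_upto t i p) (aeval_mem_upto t i q)

theorem IsSimpleAt.isProper {f : K} (hf : IsSimpleAt D t i f) : IsProper C t i f := by
  obtain ⟨p, q, e, h, _, hf, _⟩ := hf
  exact ⟨p, q, h, hf⟩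

theorem IsProper.isCoeff {f : K} (hf : IsProper C t i f) : IsCoeff C t i f := by
  rcases eq_or_ne i 0 with rfl | h
  · exact Or.inl ⟨rfl, hf.mem_upto⟩
  · exact Or.inr ⟨Fin.pos_iff_ne_zero.2 h, hf⟩

/-- Being proper does not depend on the representing fraction. -/
theorem IsProper.degree_lt_of_mul (h : Transcendental (below C t i) (t i)) {f : K}
    (hf : IsProper C t i f) {p q : (below C t i)[X]} (hq : q ≠ 0)
    (hpq : f * aeval (t i) q = aeval (t i) p) : p.degree < q.degree := by
  obtain ⟨a, b, hab, rfl⟩ := hf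
  have hb : b ≠ 0 := by rintro rfl; simp at hab
  have hb' := aeval_ne_zero h hb
  have h1 : a * q = p * b := transcendental_iff_injective.1 h (by
    rw [map_mul, map_mul, ← hpq]; field_simp)
  have h2 : a.degree + q.degree < b.degree + q.degree :=
    WithBot.add_lt_add_right (degree_eq_bot.not.2 hq) hab
  rw [← degree_mul, h1, degree_mul, add_comm b.degree] at h2
  exact lt_of_add_lt_add_right h2

theorem IsProper.eq_zero_of_aeval (h : Transcendental (below C t i) (t i))
    {p : (below C t i)[X]} (hf : IsProper C t i (aeval (t i) p)) : p = 0 := by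
  have := hf.degree_lt_of_mul h (p := p) one_ne_zero (by simp)
  rw [degree_one] at this
  exact degree_eq_bot.1 (Nat.WithBot.lt_zero_iff.1 this)

theorem IsProper.neg {f : K} (hf : IsProper C t i f) : IsProper C t i (-f) := by
  obtain ⟨p, q, h, rfl⟩ := hf
  exact ⟨-p, q, by rwa [degree_neg], by rw [map_neg, neg_div]⟩

theorem IsProper.add (h : Transcendental (below C t i) (t i)) {a b : K}
    (ha : IsProper C t i a) (hb : IsProper C t i b) : IsProper C t i (a + b) := by
  rw [← sub_neg_eq_add]
  exact ha.sub h hb.neg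

/-- Elements of `K_i` as reduced fractions. -/
theorem exists_coprime_of_mem_upto (h : Transcendental (below C t i) (t i)) {f : K}
    (hf : f ∈ upto C t i) : ∃ A B : (below C t i)[X], B ≠ 0 ∧ IsCoprime A B ∧
      f = aeval (t i) A / aeval (t i) B := by
  obtain ⟨p, q, rfl⟩ := exists_div_of_mem_upto hf
  rcases eq_or_ne q 0 with rfl | hq
  · exact ⟨0, 1, one_ne_zero, isCoprime_zero_left.2 isUnit_one, by simp⟩
  have hg : EuclideanDomain.gcd p q ≠ 0 := fun h0 => hq (EuclideanDomain.gcd_eq_zero_iff.1 h0).2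
  obtain ⟨a, ha⟩ := EuclideanDomain.gcd_dvd_left p q
  obtain ⟨b, hb⟩ := EuclideanDomain.gcd_dvd_right p q
  have hab : IsCoprime a b := by
    refine ⟨EuclideanDomain.gcdA p q, EuclideanDomain.gcdB p q, mul_left_cancel₀ hg ?_⟩
    have := EuclideanDomain.gcd_eq_gcd_ab p q
    linear_combination (-EuclideanDomain.gcdA p q) * ha - EuclideanDomain.gcdB p q * hb - this
  refine ⟨a, b, ?_, hab, ?_⟩
  · rintro rfl
    rw [mul_zero] at hb
    exact hq hb
  · have h1 := mul_div_mul_left (aeval (t i) a) (aeval (t i) b) (aeval_ne_zero h hg)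
    rwa [← map_mul, ← map_mul, ← ha, ← hb] at h1

/-- Every element of `K_i` is the sum of a polynomial in `t_i` and a reduced proper fraction. -/
theorem exists_poly_add_proper (h : Transcendental (below C t i) (t i)) {f : K}
    (hf : f ∈ upto C t i) : ∃ U A B : (below C t i)[X], B ≠ 0 ∧ IsCoprime A B ∧
      A.degree < B.degree ∧ f = aeval (t i) U + aeval (t i) A / aeval (t i) B := by
  obtain ⟨A, B, hB, hAB, rfl⟩ := exists_coprime_of_mem_upto h hf
  have h1 := EuclideanDomain.div_add_mod A B
  refine ⟨A / B, A % B, B, hB, ?_, EuclideanDomain.mod_lt _ hB, ?_⟩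
  · rw [← h1, add_comm] at hAB
    exact IsCoprime.of_add_mul_left_left hAB
  · have hB' := aeval_ne_zero h hB
    conv_lhs => rw [← h1]
    rw [map_add, map_mul]
    field_simp

theorem deriv_aeval_div (ht : IsPrimitive D t) (A : (below C t i)[X]) {B : (below C t i)[X]}
    (hB : B ≠ 0) : D (aeval (t i) A / aeval (t i) B) =
      aeval (t i) (polyDeriv ht i A * B - A * polyDeriv ht i B) / aeval (t i) (B ^ 2) := by
  have hB' := aeval_ne_zero (ht.transcendental i) hB
  rw [Derivation.leibniz_div]
  simp only [map_sub, map_mul, map_pow, aeval_polyDeriv, smul_eq_mul]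
  field_simp

theorem IsProper.deriv (ht : IsPrimitive D t) {f : K} (hf : IsProper C t i f) :
    IsProper C t i (D f) := by
  obtain ⟨p, q, h, rfl⟩ := hf
  have hq : q ≠ 0 := by rintro rfl; simp at h
  have hq' : q.degree ≠ ⊥ := degree_eq_bot.not.2 hq
  rw [deriv_aeval_div ht p hq]
  refine ⟨_, _, ?_, rfl⟩
  rw [sq]
  refine (degree_sub_le _ _).trans_lt (max_lt ?_ ?_) <;> rw [degree_mul, degree_mul]
  · exact WithBot.add_lt_add_right hq' ((degree_polyDeriv_le ht p).trans_lt h)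
  · exact (add_le_add_right (degree_polyDeriv_le ht q) _).trans_lt
      (WithBot.add_lt_add_right hq' h)

theorem IsCoeff.deriv (ht : IsPrimitive D t) {f : K} (hf : IsCoeff C t i f) :
    IsCoeff C t i (D f) := by
  rcases hf with ⟨h0, hf⟩ | ⟨h0, hf⟩
  · exact Or.inl ⟨h0, ht.deriv_mem_upto hf⟩
  · exact Or.inr ⟨h0, hf.deriv ht⟩

/-- As irreducible polynomials are normal, being `t_i`-simple means being `t_i`-proper with a
squarefree denominator; the fraction need not be reduced. -/
theorem isSimpleAt_iff [CharZero C] (ht : IsPrimitive D t) {f : K} :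
    IsSimpleAt D t i f ↔ IsProper C t i f ∧ ∃ p q : (below C t i)[X], Squarefree q ∧
      f = aeval (t i) p / aeval (t i) q := by
  have htr := ht.transcendental i
  constructor
  · intro hf
    refine ⟨hf.isProper, ?_⟩
    obtain ⟨p, q, e, _, _, hf, he, hqe⟩ := hf
    refine ⟨p, q, squarefree_of_isCoprime_derivation (polyDeriv ht i) ?_, hf⟩
    rwa [← ht.aeval_injective i (he.trans (aeval_polyDeriv ht q).symm)]
  · rintro ⟨hf, p, q, hq, hpq⟩
    obtain ⟨A, B, hB, hAB, h1⟩ := exists_coprime_of_mem_upto htr hf.mem_upto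
    have hB' := aeval_ne_zero htr hB
    have hq' := aeval_ne_zero htr hq.ne_zero
    have hBq : B ∣ q := by
      refine hAB.symm.dvd_of_dvd_mul_left (z := q) ⟨p, transcendental_iff_injective.1 htr ?_⟩
      rw [h1, div_eq_div_iff hB' hq'] at hpq
      rw [map_mul, map_mul, hpq, mul_comm]
    refine ⟨A, B, polyDeriv ht i B, hf.degree_lt_of_mul htr hB ?_, hAB, h1,
      aeval_polyDeriv ht B, ?_⟩
    · rw [h1]; field_simp
    · exact isCoprime_derivation_of_squarefree _ (fun π hπ => not_dvd_polyDeriv ht hπ)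
        (hq.squarefree_of_dvd hBq)

theorem IsSimpleAt.add [CharZero C] (ht : IsPrimitive D t) {a b : K} (ha : IsSimpleAt D t i a)
    (hb : IsSimpleAt D t i b) : IsSimpleAt D t i (a + b) := by
  have htr := ht.transcendental i
  rw [isSimpleAt_iff ht] at ha hb ⊢
  obtain ⟨ha, p, q, hq, rfl⟩ := ha
  obtain ⟨hb, r, s, hs, rfl⟩ := hb
  refine ⟨ha.add htr hb, ?_⟩
  obtain ⟨L, hL, ⟨x, hx⟩, ⟨y, hy⟩⟩ := exists_squarefree_common hq hs
  refine ⟨p * x + r * y, L, hL, ?_⟩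
  have hq' := aeval_ne_zero htr hq.ne_zero
  have hs' := aeval_ne_zero htr hs.ne_zero
  have hL' := aeval_ne_zero htr hL.ne_zero
  have h1 : aeval (t i) p / aeval (t i) q = aeval (t i) (p * x) / aeval (t i) L := by
    rw [div_eq_div_iff hq' hL', hx]; simp only [map_mul]; ring
  have h2 : aeval (t i) r / aeval (t i) s = aeval (t i) (r * y) / aeval (t i) L := by
    rw [div_eq_div_iff hs' hL', hy]; simp only [map_mul]; ring
  rw [h1, h2, map_add, add_div]

theorem IsSimpleAt.smul [CharZero C] (ht : IsPrimitive D t) {a : K} (c : C)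
    (ha : IsSimpleAt D t i a) :
    IsSimpleAt D t i (c • a) := by
  rw [isSimpleAt_iff ht] at ha ⊢
  have key : ∀ p q : (below C t i)[X], c • (aeval (t i) p / aeval (t i) q) =
      aeval (t i) (Polynomial.C (algebraMap C (below C t i) c) * p) / aeval (t i) q := by
    intro p q
    rw [map_mul, aeval_C, mul_div_assoc, Algebra.smul_def]
    rfl
  obtain ⟨⟨p, q, h, hf⟩, r, s, hs, hf'⟩ := ha
  refine ⟨⟨_, q, ?_, by rw [hf, key]⟩, _, s, hs, by rw [hf', key]⟩
  exact (degree_mul_le _ _).trans_lt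
    ((add_le_add_left degree_C_le _).trans_lt (by rwa [zero_add]))

theorem IsSimpleAt.zero [CharZero C] (ht : IsPrimitive D t) : IsSimpleAt D t i (0 : K) :=
  (isSimpleAt_iff ht).2 ⟨.of_zero, 0, 1, squarefree_one, by simp⟩

/-- An element of `K_i` with simple derivative is a polynomial in `t_i`, because poles of a
derivative are multiple; so that derivative is polynomial and proper, which leaves `0`. -/
theorem exists_poly_of_simple_deriv [CharZero C] (ht : IsPrimitive D t) {b : K}
    (hb : b ∈ upto C t i) (hs : IsSimpleAt D t i (D b)) :
    ∃ V : (below C t i)[X], b = aeval (t i) V ∧ polyDeriv ht i V = 0 := by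
  have htr := ht.transcendental i
  have := charZero_below C t i
  have hprop := hs.isProper
  obtain ⟨A, B, hB, hAB, rfl⟩ := exists_coprime_of_mem_upto htr hb
  obtain ⟨-, N, S, hS, h1⟩ := (isSimpleAt_iff ht).1 hs
  have hB' := aeval_ne_zero htr hB
  have hS' := aeval_ne_zero htr hS.ne_zero
  have hu : IsUnit B := by
    refine isUnit_of_squarefree (N := N) (polyDeriv ht i) (fun π hπ => not_dvd_polyDeriv ht hπ)
      hB hAB hS (transcendental_iff_injective.1 htr ?_)
    rw [deriv_aeval_div ht A hB, div_eq_div_iff (by rw [map_pow]; exact pow_ne_zero 2 hB') hS']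
      at h1
    rw [map_mul, map_mul, h1]
  obtain ⟨c, hc⟩ := hu.dvd (a := A)
  have hV : aeval (t i) A / aeval (t i) B = aeval (t i) c := by
    rw [div_eq_iff hB', ← map_mul, mul_comm, ← hc]
  refine ⟨c, hV, ?_⟩
  rw [hV, ← aeval_polyDeriv ht] at hprop
  exact hprop.eq_zero_of_aeval htr

theorem deriv_eq_zero_of_simple [CharZero C] (ht : IsPrimitive D t) {b : K} (hb : b ∈ upto C t i)
    (hs : IsSimpleAt D t i (D b)) : D b = 0 := by
  obtain ⟨V, rfl, hV⟩ := exists_poly_of_simple_deriv ht hb hs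
  rw [← aeval_polyDeriv ht, hV, map_zero]

/-- The field of constants of the tower is `C`. -/
theorem mem_bot_of_deriv_eq_zero [CharZero C] (ht : IsPrimitive D t) {f : K} (hf : D f = 0) :
    f ∈ (⊥ : IntermediateField C K) := by
  have key : ∀ j : Fin (n + 1), f ∈ upto C t j → f ∈ (⊥ : IntermediateField C K) := by
    intro j
    induction j using Fin.induction with
    | zero =>
      intro hj
      have := charZero_below C t 0
      obtain ⟨V, rfl, hV⟩ := exists_poly_of_simple_deriv ht hj (by rw [hf]; exact .zero ht)
      rw [polyDeriv_zero_level] at hV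
      rw [eq_C_of_natDegree_eq_zero (derivative_eq_zero.1 hV), aeval_C]
      exact mem_bot_of_mem_below_zero (V.coeff 0).2
    | succ j ih =>
      intro hj
      have := ht.constants j.succ (Fin.succ_pos j) f hj hf
      rw [below_succ] at this
      exact ih this
  exact key (Fin.last n) (ht.top ▸ IntermediateField.mem_top)

/-- Hermite reduction of proper fractions, by induction on the degree of the denominator: as long
as some `π ^ 2` divides it, subtracting the derivative of a suitable `c / π ^ (k + 1)` lowers the
order of the pole at `π`. -/
theorem IsProper.exists_hermite [CharZero C] (ht : IsPrimitive D t) (m : ℕ) :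
    ∀ A B : (below C t i)[X], B.natDegree ≤ m → A.degree < B.degree →
      ∃ b h : K, IsProper C t i b ∧ IsSimpleAt D t i h ∧
        aeval (t i) A / aeval (t i) B = D b + h := by
  have htr := ht.transcendental i
  have := charZero_below C t i
  induction m with
  | zero =>
    intro A B hB hAB
    refine ⟨0, aeval (t i) A / aeval (t i) B, .of_zero, (isSimpleAt_iff ht).2
      ⟨⟨A, B, hAB, rfl⟩, A, B, ?_, rfl⟩, by simp⟩
    have hB0 : B ≠ 0 := by rintro rfl; simp at hAB
    exact (isUnit_iff_degree_eq_zero.2 (by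
      rw [degree_eq_natDegree hB0, Nat.le_zero.1 hB]; rfl)).squarefree
  | succ m ih =>
    intro A B hB hAB
    have hB0 : B ≠ 0 := by rintro rfl; simp at hAB
    by_cases hsq : Squarefree B
    · exact ⟨0, aeval (t i) A / aeval (t i) B, .of_zero, (isSimpleAt_iff ht).2
        ⟨⟨A, B, hAB, rfl⟩, A, B, hsq, rfl⟩, by simp⟩
    obtain ⟨π, hπ, hd⟩ : ∃ π, Irreducible π ∧ π * π ∣ B := by
      by_contra hcon
      push Not at hcon
      exact hsq ((squarefree_iff_irreducible_sq_not_dvd_of_ne_zero hB0).2 hcon)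
    obtain ⟨E, hE, hEd⟩ := (FiniteMultiplicity.of_not_isUnit hπ.not_isUnit
      hB0).exists_eq_pow_mul_and_not_dvd
    obtain ⟨k, hk⟩ : ∃ k, multiplicity π B = k + 2 := by
      have : 2 ≤ multiplicity π B := (FiniteMultiplicity.of_not_isUnit hπ.not_isUnit
        hB0).le_multiplicity_of_pow_dvd (by rwa [sq])
      exact ⟨multiplicity π B - 2, by omega⟩
    rw [hk] at hE
    obtain ⟨c, hc, y, hy⟩ := exists_hermite_numerator (polyDeriv ht i)
      (fun π hπ => not_dvd_polyDeriv ht hπ) hπ hEd A k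
    have hπ0 := hπ.ne_zero
    have hE0 : E ≠ 0 := by rintro rfl; simp at hE; exact hB0 hE
    have hb : IsProper C t i (aeval (t i) c / aeval (t i) (π ^ (k + 1))) := by
      refine ⟨c, _, hc.trans_le ?_, rfl⟩
      exact degree_le_of_dvd (dvd_pow_self π (Nat.succ_ne_zero k)) (pow_ne_zero _ hπ0)
    have hπ' := aeval_ne_zero htr hπ0
    have hE' := aeval_ne_zero htr hE0
    have hB'0 : π ^ (k + 1) * E ≠ 0 := mul_ne_zero (pow_ne_zero _ hπ0) hE0
    have key : aeval (t i) A / aeval (t i) B =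
        D (aeval (t i) c / aeval (t i) (π ^ (k + 1))) +
          aeval (t i) (y - polyDeriv ht i c * E) / aeval (t i) (π ^ (k + 1) * E) := by
      rw [deriv_aeval_div ht c (pow_ne_zero _ hπ0), hE, Derivation.leibniz_pow]
      have hy' := congrArg (aeval (t i)) hy
      simp only [map_add, map_mul, map_natCast] at hy'
      simp only [map_sub, map_mul, map_pow, smul_eq_mul, nsmul_eq_mul, map_natCast,
        Nat.add_sub_cancel]
      field_simp
      linear_combination aeval (t i) π ^ (2 * k + 2) * hy'
    have hdeg : (y - polyDeriv ht i c * E).degree < (π ^ (k + 1) * E).degree := by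
      have h1 : IsProper C t i (aeval (t i) A / aeval (t i) B) := ⟨A, B, hAB, rfl⟩
      have h2 := h1.sub htr (hb.deriv ht)
      rw [key, add_sub_cancel_left] at h2
      refine h2.degree_lt_of_mul htr hB'0 ?_
      rw [div_mul_cancel₀ _ (aeval_ne_zero htr hB'0)]
    obtain ⟨b, h, hb2, hh, hbh⟩ := ih _ (π ^ (k + 1) * E) (by
      have h3 : B = π * (π ^ (k + 1) * E) := by rw [hE]; ring
      rw [h3, natDegree_mul hπ0 hB'0] at hB
      have := hπ.natDegree_pos
      omega) hdeg
    refine ⟨_, h, hb.add htr hb2, hh, ?_⟩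
    rw [key, hbh, map_add, add_assoc]

/-- In `C[x]` every polynomial has an antiderivative. -/
theorem exists_polyDeriv_eq [CharZero C] (ht : IsPrimitive D t) (p : (below C t 0)[X]) :
    ∃ q, polyDeriv ht 0 q = p := by
  have := charZero_below C t 0
  induction p using Polynomial.induction_on' with
  | add p q hp hq =>
    obtain ⟨a, rfl⟩ := hp
    obtain ⟨b, rfl⟩ := hq
    exact ⟨a + b, map_add _ _ _⟩
  | monomial k a =>
    refine ⟨Polynomial.C (a / (k + 1)) * X ^ (k + 1), ?_⟩
    rw [polyDeriv_zero_level, derivative_C_mul_X_pow, ← C_mul_X_pow_eq_monomial]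
    congr 2
    have : ((k : below C t 0) + 1) ≠ 0 := Nat.cast_add_one_ne_zero k
    push_cast
    field_simp

/-- Coefficients have a Hermite reduction. -/
theorem IsCoeff.exists_hermite [CharZero C] (ht : IsPrimitive D t) {a : K} (ha : IsCoeff C t i a) :
    ∃ b h, IsHermite D t i a b h := by
  rcases ha with ⟨rfl, ha⟩ | ⟨hi, p, q, hpq, rfl⟩
  · obtain ⟨U, A, B, _, _, hdeg, rfl⟩ := exists_poly_add_proper (ht.transcendental 0) ha
    obtain ⟨V, rfl⟩ := exists_polyDeriv_eq ht U
    obtain ⟨b, h, hb, hh, hbh⟩ := IsProper.exists_hermite ht _ A B le_rfl hdeg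
    refine ⟨aeval (t 0) V + b, h, Or.inl ⟨rfl, add_mem (aeval_mem_upto t 0 V) hb.mem_upto⟩,
      hh, ?_⟩
    rw [hbh, map_add, aeval_polyDeriv, add_assoc]
  · obtain ⟨b, h, hb, hh, hbh⟩ := IsProper.exists_hermite ht _ p q le_rfl hpq
    exact ⟨b, h, Or.inr ⟨hi, hb⟩, hh, hbh⟩

/-! ### The degree of the denominator in the last generator -/

theorem IsPrimitive.mem_upto_last (ht : IsPrimitive D t) (f : K) : f ∈ upto C t (Fin.last n) :=
  ht.top ▸ IntermediateField.mem_top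

theorem denDeg_eq (ht : IsPrimitive D t) {p q : (below C t (Fin.last n))[X]} (hq : q ≠ 0)
    (hpq : IsCoprime p q) : denDeg C t
      (aeval (t (Fin.last n)) p / aeval (t (Fin.last n)) q) = q.natDegree := by
  have htr := ht.transcendental (Fin.last n)
  have key : {d | ∃ a b : (below C t (Fin.last n))[X], b ≠ 0 ∧ IsCoprime a b ∧
      aeval (t (Fin.last n)) p / aeval (t (Fin.last n)) q =
        aeval (t (Fin.last n)) a / aeval (t (Fin.last n)) b ∧ b.natDegree = d} =
      {q.natDegree} := by
    ext d
    constructor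
    · rintro ⟨a, b, hb, hab, h, rfl⟩
      rw [div_eq_div_iff (aeval_ne_zero htr hq) (aeval_ne_zero htr hb), ← map_mul, ← map_mul] at h
      have h1 := transcendental_iff_injective.1 htr h
      have h2 : q ∣ b := hpq.symm.dvd_of_dvd_mul_left ⟨a, by rw [h1, mul_comm]⟩
      have h3 : b ∣ q := hab.symm.dvd_of_dvd_mul_left ⟨p, by rw [← h1, mul_comm]⟩
      exact natDegree_eq_of_degree_eq (degree_eq_degree_of_associated
        (associated_of_dvd_dvd h3 h2))
    · rintro rfl
      exact ⟨p, q, hq, hpq, rfl, rfl⟩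
  rw [denDeg, key, csInf_singleton]

theorem denDeg_zero (ht : IsPrimitive D t) : denDeg C t (0 : K) = 0 := by
  have := denDeg_eq ht (p := 0) one_ne_zero isCoprime_one_right
  simpa using this

/-- If `r` is the sum of a polynomial in `t_n` and a simple element, then adding a derivative `u'`
to it does not lower the degree of the denominator, and strictly raises it unless `u` is a
polynomial in `t_n`. -/
theorem exists_poly_of_denDeg_le [CharZero C] (ht : IsPrimitive D t) {ρ u : K}
    {R : (below C t (Fin.last n))[X]} (hρ : IsSimpleAt D t (Fin.last n) ρ)
    (hdeg : denDeg C t (aeval (t (Fin.last n)) R + ρ + D u) ≤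
      denDeg C t (aeval (t (Fin.last n)) R + ρ)) :
    (∃ U : (below C t (Fin.last n))[X], u = aeval (t (Fin.last n)) U) ∧
      denDeg C t (aeval (t (Fin.last n)) R + ρ + D u) =
        denDeg C t (aeval (t (Fin.last n)) R + ρ) := by
  have htr := ht.transcendental (Fin.last n)
  have := charZero_below C t (Fin.last n)
  obtain ⟨p, q, e, _, hpq, rfl, he, hqe⟩ := hρ
  rw [← aeval_polyDeriv ht] at he
  rw [ht.aeval_injective _ he] at hqe
  have hq := squarefree_of_isCoprime_derivation _ hqe
  have hq' := aeval_ne_zero htr hq.ne_zero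
  have hr : aeval (t (Fin.last n)) R + aeval (t (Fin.last n)) p / aeval (t (Fin.last n)) q =
      aeval (t (Fin.last n)) (p + R * q) / aeval (t (Fin.last n)) q := by
    rw [map_add, map_mul]; field_simp; ring
  have hrdeg := denDeg_eq ht hq.ne_zero ((IsCoprime.add_mul_right_left hpq R))
  obtain ⟨A, B, hB, hAB, rfl⟩ := exists_coprime_of_mem_upto htr (ht.mem_upto_last u)
  have hB' := aeval_ne_zero htr hB
  obtain ⟨N, S, hS, hNS, hs⟩ := exists_coprime_of_mem_upto htr (ht.mem_upto_last
    (aeval (t (Fin.last n)) R + aeval (t (Fin.last n)) p / aeval (t (Fin.last n)) q +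
      D (aeval (t (Fin.last n)) A / aeval (t (Fin.last n)) B)))
  have hS' := aeval_ne_zero htr hS
  have hsdeg := denDeg_eq ht hS hNS
  have hid : (p * B ^ 2 + q * (polyDeriv ht _ A * B - A * polyDeriv ht _ B)) * S =
      (N - R * S) * q * B ^ 2 := by
    apply transcendental_iff_injective.1 htr
    rw [deriv_aeval_div ht A hB] at hs
    simp only [map_add, map_mul, map_sub, map_pow] at hs ⊢
    field_simp at hs
    linear_combination hs
  rw [hs, hr, hrdeg, hsdeg] at hdeg ⊢
  have hdvd := squarefree_dvd_denominator _ (fun π hπ => not_dvd_polyDeriv ht hπ) hB hAB hpq hq hid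
  refine ⟨?_, le_antisymm hdeg (natDegree_le_of_dvd hdvd hS)⟩
  obtain ⟨c, hc⟩ := (isUnit_of_natDegree_le _ (fun π hπ => not_dvd_polyDeriv ht hπ) hB hAB hpq hq
    hS hdeg hid).dvd (a := A)
  exact ⟨c, by rw [div_eq_iff hB', ← map_mul, mul_comm, ← hc]⟩

end Simple

end Poles

/-! ### Coefficients of the matryoshka decomposition -/

section Coeffs

variable {C K : Type*} [Field C] [Field K] [Algebra C K] {n : ℕ}
  {D : Derivation C K K} {t : Fin (n + 1) → K}

theorem isMatryoshka_coeffs (ht : IsPrimitive D t) (f : K) :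
    IsMatryoshka C t (coeffs C t f) f := by
  have h := (existsUnique_matryoshka ht f).exists
  rw [coeffs, dif_pos h]
  exact h.choose_spec

theorem coeffs_eq (ht : IsPrimitive D t) {f : K} {c : Fin (n + 1) → (Fin (n + 1) → ℕ) →₀ K}
    (h : IsMatryoshka C t c f) : coeffs C t f = c :=
  (existsUnique_matryoshka ht f).unique (isMatryoshka_coeffs ht f) h

theorem coeffs_sub (ht : IsPrimitive D t) (f g : K) :
    coeffs C t (f - g) = coeffs C t f - coeffs C t g :=
  coeffs_eq ht ((isMatryoshka_coeffs ht f).sub ht.transcendental (isMatryoshka_coeffs ht g))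

theorem coeffs_zero (ht : IsPrimitive D t) : coeffs C t (0 : K) = 0 :=
  coeffs_eq ht (isMatryoshka_zero t)

theorem coeffs_add (ht : IsPrimitive D t) (f g : K) :
    coeffs C t (f + g) = coeffs C t f + coeffs C t g := by
  rw [← sub_neg_eq_add f g, ← zero_sub, coeffs_sub ht, coeffs_sub ht, coeffs_zero ht,
    zero_sub, sub_neg_eq_add]

/-- The coefficient of `t ^ e` in `π_i(f)`, as an additive function of `f`. -/
def coeffHom (ht : IsPrimitive D t) (i : Fin (n + 1)) (e : Fin (n + 1) → ℕ) : K →+ K where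
  toFun f := coeffs C t f i e
  map_zero' := by rw [coeffs_zero ht]; rfl
  map_add' f g := by rw [coeffs_add ht]; rfl

/-- The sum of the coefficients of the monomial `M` in all components of `f`. -/
def totalCoeff (ht : IsPrimitive D t) (M : Mono n) : K →+ K :=
  ∑ i, coeffHom ht i (ofColex M)

theorem totalCoeff_apply (ht : IsPrimitive D t) (M : Mono n) (f : K) :
    totalCoeff ht M f = ∑ i, coeffs C t f i (ofColex M) := by
  simp [totalCoeff, coeffHom]

/-- The elements in whose decomposition `t ^ e` occurs in the `i`-th component only if `P i e`. -/
def suppIn (ht : IsPrimitive D t) (P : Fin (n + 1) → (Fin (n + 1) → ℕ) → Prop) :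
    AddSubgroup K where
  carrier := {f | ∀ i e, coeffs C t f i e ≠ 0 → P i e}
  zero_mem' i e h := by simp [coeffs_zero ht] at h
  add_mem' {f g} hf hg i e h := by
    by_cases h1 : coeffs C t f i e = 0
    · refine hg i e fun h2 => h ?_
      simp [coeffs_add ht, h1, h2]
    · exact hf i e h1
  neg_mem' {f} hf i e h := by
    refine hf i e fun h1 => h ?_
    rw [← zero_sub, coeffs_sub ht, coeffs_zero ht]
    simp [h1]

theorem suppIn_mono (ht : IsPrimitive D t) {P Q : Fin (n + 1) → (Fin (n + 1) → ℕ) → Prop}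
    (h : ∀ i e, P i e → Q i e) : suppIn ht P ≤ suppIn ht Q :=
  fun _ hf i e he => h i e (hf i e he)

theorem totalCoeff_eq_zero (ht : IsPrimitive D t) {P : Fin (n + 1) → (Fin (n + 1) → ℕ) → Prop}
    {f : K} (hf : f ∈ suppIn ht P) {M : Mono n} (hM : ∀ i, ¬ P i (ofColex M)) :
    totalCoeff ht M f = 0 := by
  rw [totalCoeff_apply]
  refine Finset.sum_eq_zero fun i _ => ?_
  by_contra h
  exact hM i (hf i _ h)

theorem coeffs_mul_mon (ht : IsPrimitive D t) {i : Fin (n + 1)} {a : K} (ha : IsCoeff C t i a)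
    {e : Fin (n + 1) → ℕ} (he : InT i e) :
    coeffs C t (a * mon t e) = Pi.single i (Finsupp.single e a) := by
  refine coeffs_eq ht ⟨?_, ?_, ?_⟩
  · intro j e' hj
    rcases eq_or_ne j i with rfl | hji
    · rw [Pi.single_eq_same, Finsupp.single_apply] at hj
      split_ifs at hj with h1
      · exact h1 ▸ he
      · simp at hj
    · simp [Pi.single_eq_of_ne hji] at hj
  · intro j e'
    rcases eq_or_ne j i with rfl | hji
    · rw [Pi.single_eq_same, Finsupp.single_apply]
      split_ifs
      · exact ha
      · exact .of_zero
    · rw [Pi.single_eq_of_ne hji]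
      exact .of_zero
  · rw [Finset.sum_eq_single i]
    · simp [evalMon]
    · intro j _ hji
      simp [Pi.single_eq_of_ne hji, evalMon]
    · simp

theorem coeffs_of_isCoeff (ht : IsPrimitive D t) {i : Fin (n + 1)} {a : K}
    (ha : IsCoeff C t i a) : coeffs C t a = Pi.single i (Finsupp.single 0 a) := by
  have := coeffs_mul_mon ht ha (e := 0) (fun _ _ => rfl)
  rwa [mon_zero, mul_one] at this

theorem mul_mon_mem_suppIn_of_isCoeff (ht : IsPrimitive D t) {i : Fin (n + 1)} {a : K}
    (ha : IsCoeff C t i a) {e : Fin (n + 1) → ℕ} (he : InT i e) :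
    a * mon t e ∈ suppIn ht fun j e' => j = i ∧ e' = e := by
  intro j e' h
  rw [coeffs_mul_mon ht ha he] at h
  rcases eq_or_ne j i with rfl | hji
  · refine ⟨rfl, ?_⟩
    rw [Pi.single_eq_same, Finsupp.single_apply] at h
    by_contra hne
    exact h (if_neg (Ne.symm hne))
  · simp [Pi.single_eq_of_ne hji] at h

theorem totalCoeff_mul_mon (ht : IsPrimitive D t) {i : Fin (n + 1)} {a : K}
    (ha : IsCoeff C t i a) {e : Fin (n + 1) → ℕ} (he : InT i e) (M : Mono n) :
    totalCoeff ht M (a * mon t e) = if ofColex M = e then a else 0 := by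
  rw [totalCoeff_apply, coeffs_mul_mon ht ha he, Finset.sum_eq_single i]
  · rw [Pi.single_eq_same, Finsupp.single_apply]
    exact if_congr eq_comm rfl rfl
  · intro j _ hj
    simp [Pi.single_eq_of_ne hj]
  · simp

/-- Decomposing `g * t ^ e` with `g ∈ K_j` leaves the exponents of `t_{j+1}, …, t_n` alone. -/
theorem mul_mon_mem_suppIn_of_inT (ht : IsPrimitive D t) (j : Fin (n + 1)) :
    ∀ g ∈ upto C t j, ∀ e, InT j e →
      g * mon t e ∈ suppIn ht fun i e' => i ≤ j ∧ ∀ l, j < l → e' l = e l := by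
  induction j using Fin.induction with
  | zero =>
    intro g hg e he
    refine suppIn_mono ht ?_ (mul_mon_mem_suppIn_of_isCoeff ht (Or.inl ⟨rfl, hg⟩) he)
    rintro i e' ⟨rfl, rfl⟩
    exact ⟨le_rfl, fun _ _ => rfl⟩
  | succ j ih =>
    intro f hf e he
    obtain ⟨U, A, B, _, _, hdeg, rfl⟩ := exists_poly_add_proper (ht.transcendental _) hf
    rw [add_mul]
    refine add_mem ?_ (suppIn_mono ht ?_ (mul_mon_mem_suppIn_of_isCoeff ht
      (IsProper.isCoeff ⟨A, B, hdeg, rfl⟩) he))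
    · rw [Polynomial.aeval_eq_sum_range, Finset.sum_mul]
      refine sum_mem fun k _ => ?_
      have hmem : ((U.coeff k : below C t j.succ) : K) ∈ upto C t j.castSucc :=
        below_succ (C := C) t j ▸ (U.coeff k).2
      have := ih _ hmem (Pi.single j.succ k + e) (by
        intro l hl
        have h1 : l < j.succ := lt_of_le_of_lt hl Fin.castSucc_lt_succ
        simp [Pi.single_eq_of_ne h1.ne, he l h1.le])
      rw [mon_add, mon_single, ← mul_assoc] at this
      rw [Algebra.smul_def]
      refine suppIn_mono ht ?_ this
      rintro i e' ⟨hi, he'⟩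
      refine ⟨hi.trans Fin.castSucc_lt_succ.le, fun l hl => ?_⟩
      rw [he' l (Fin.castSucc_lt_succ.trans hl), Pi.add_apply, Pi.single_eq_of_ne hl.ne', zero_add]
    · rintro i e' ⟨rfl, rfl⟩
      exact ⟨le_rfl, fun _ _ => rfl⟩

theorem mon_mem_upto (t : Fin (n + 1) → K) (j : Fin (n + 1)) (e : Fin (n + 1) → ℕ)
    (he : ∀ l, j < l → e l = 0) : mon t e ∈ upto C t j := by
  refine prod_mem fun l _ => ?_
  rcases lt_or_ge j l with hl | hl
  · simp [he l hl, one_mem]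
  · exact pow_mem (IntermediateField.subset_adjoin C _ (Set.mem_image_of_mem t hl)) _

theorem mul_mon_mem_suppIn (ht : IsPrimitive D t) {j : Fin (n + 1)} {g : K}
    (hg : g ∈ upto C t j) (e : Fin (n + 1) → ℕ) :
    g * mon t e ∈ suppIn ht fun i e' => i ≤ j ∧ ∀ l, j < l → e' l = e l := by
  let e₁ : Fin (n + 1) → ℕ := fun l => if l ≤ j then e l else 0
  let e₂ : Fin (n + 1) → ℕ := fun l => if l ≤ j then 0 else e l
  have he : e = e₁ + e₂ := by
    ext l
    by_cases hl : l ≤ j <;> simp [e₁, e₂, hl]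
  have h1 : mon t e₁ ∈ upto C t j := mon_mem_upto t j e₁ fun l hl => if_neg (not_le.2 hl)
  have h2 := mul_mon_mem_suppIn_of_inT ht j _ (mul_mem hg h1) e₂ fun l hl => if_pos hl
  rw [mul_assoc, ← mon_add, ← he] at h2
  refine suppIn_mono ht ?_ h2
  rintro i e' ⟨hi, he'⟩
  refine ⟨hi, fun l hl => ?_⟩
  rw [he' l hl]
  exact if_neg (not_le.2 hl)

/-- The same for `g ∈ K_{j-1}`. -/
theorem mul_mon_mem_suppIn_of_mem_below (ht : IsPrimitive D t) {j : Fin (n + 1)} (hj : 0 < j)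
    {g : K} (hg : g ∈ below C t j) (e : Fin (n + 1) → ℕ) :
    g * mon t e ∈ suppIn ht fun i e' => i < j ∧ ∀ l, j ≤ l → e' l = e l := by
  obtain ⟨k, rfl⟩ := Fin.exists_succ_eq.2 hj.ne'
  rw [below_succ] at hg
  refine suppIn_mono ht ?_ (mul_mon_mem_suppIn ht hg e)
  rintro i e' ⟨hi, he'⟩
  exact ⟨lt_of_le_of_lt hi Fin.castSucc_lt_succ,
    fun l hl => he' l (lt_of_lt_of_le Fin.castSucc_lt_succ hl)⟩

/-! ### Flat elements -/

/-- The elements that can be the total coefficient of `M`: only the monomial `1` occurs in their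
decomposition, and only in components `P_i` that contain multiples of `M`. -/
def flat (ht : IsPrimitive D t) (M : Mono n) : AddSubgroup K :=
  suppIn ht fun i e => e = 0 ∧ InT i (ofColex M)

theorem eq_sum_coeffs_of_mem_flat (ht : IsPrimitive D t) {M : Mono n} {a : K}
    (ha : a ∈ flat ht M) : a = ∑ i, coeffs C t a i 0 := by
  conv_lhs => rw [(isMatryoshka_coeffs ht a).sum_eq]
  refine Finset.sum_congr rfl fun i _ => ?_
  unfold evalMon Finsupp.sum
  rw [Finset.sum_eq_single 0]
  · simp [mon_zero]
  · intro e he h0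
    exact absurd (ha i e (Finsupp.mem_support_iff.1 he)).1 h0
  · intro h0
    simp [Finsupp.notMem_support_iff.1 h0]

theorem mem_flat_of_isCoeff (ht : IsPrimitive D t) {M : Mono n} {i : Fin (n + 1)} {a : K}
    (ha : IsCoeff C t i a) (hi : InT i (ofColex M)) : a ∈ flat ht M := by
  have := mul_mon_mem_suppIn_of_isCoeff ht ha (e := 0) (fun _ _ => rfl)
  rw [mon_zero, mul_one] at this
  refine suppIn_mono ht ?_ this
  rintro j e ⟨rfl, rfl⟩
  exact ⟨rfl, hi⟩

theorem coeffs_mem_flat (ht : IsPrimitive D t) (M : Mono n) (f : K) (i : Fin (n + 1)) :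
    coeffs C t f i (ofColex M) ∈ flat ht M := by
  have hm := isMatryoshka_coeffs ht f
  by_cases h : coeffs C t f i (ofColex M) = 0
  · rw [h]; exact zero_mem _
  · exact mem_flat_of_isCoeff ht (hm.isCoeff i _) (hm.inT i _ h)

theorem totalCoeff_mem_flat (ht : IsPrimitive D t) (M : Mono n) (f : K) :
    totalCoeff ht M f ∈ flat ht M := by
  rw [totalCoeff_apply]
  exact sum_mem fun i _ => coeffs_mem_flat ht M f i

/-- A sum of coefficients, one for each component, determines its summands. -/
theorem coeffs_sum_isCoeff (ht : IsPrimitive D t) {a : Fin (n + 1) → K}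
    (ha : ∀ i, IsCoeff C t i (a i)) (i : Fin (n + 1)) :
    coeffs C t (∑ j, a j) i = Finsupp.single 0 (a i) := by
  ext e
  change coeffHom ht i e (∑ j, a j) = _
  rw [map_sum, Finset.sum_eq_single i]
  · change coeffs C t (a i) i e = _
    rw [coeffs_of_isCoeff ht (ha i), Pi.single_eq_same]
  · intro j _ hj
    change coeffs C t (a j) i e = _
    rw [coeffs_of_isCoeff ht (ha j), Pi.single_eq_of_ne hj.symm]
    rfl
  · simp

theorem coeffs_totalCoeff (ht : IsPrimitive D t) (M : Mono n) (f : K) (i : Fin (n + 1)) :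
    coeffs C t (totalCoeff ht M f) i = Finsupp.single 0 (coeffs C t f i (ofColex M)) := by
  rw [totalCoeff_apply]
  exact coeffs_sum_isCoeff ht (fun i => (isMatryoshka_coeffs ht f).isCoeff i _) i

theorem totalCoeff_eq_zero_iff (ht : IsPrimitive D t) {M : Mono n} {f : K} :
    totalCoeff ht M f = 0 ↔ ∀ i, coeffs C t f i (ofColex M) = 0 := by
  constructor
  · intro h i
    have h1 := coeffs_totalCoeff ht M f i
    rw [h, coeffs_zero ht] at h1
    exact (Finsupp.single_eq_zero.1 h1.symm)
  · intro h
    rw [totalCoeff_apply]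
    exact Finset.sum_eq_zero fun i _ => h i

theorem coeffs_deriv_of_mem_flat (ht : IsPrimitive D t) {M : Mono n} {a : K}
    (ha : a ∈ flat ht M) (i : Fin (n + 1)) :
    coeffs C t (D a) i = Finsupp.single 0 (D (coeffs C t a i 0)) := by
  conv_lhs => rw [eq_sum_coeffs_of_mem_flat ht ha, map_sum]
  exact coeffs_sum_isCoeff ht (fun j => ((isMatryoshka_coeffs ht a).isCoeff j 0).deriv ht) i

theorem deriv_mem_flat (ht : IsPrimitive D t) {M : Mono n} {a : K} (ha : a ∈ flat ht M) :
    D a ∈ flat ht M := by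
  intro i e h
  rw [coeffs_deriv_of_mem_flat ht ha, Finsupp.single_apply] at h
  split_ifs at h with h0
  · refine ⟨h0.symm, (ha i 0 fun h1 => h ?_).2⟩
    rw [h1, map_zero]
  · exact absurd rfl h

theorem coeffs_flat_mul_mon (ht : IsPrimitive D t) {M : Mono n} {a : K} (ha : a ∈ flat ht M)
    (i : Fin (n + 1)) : coeffs C t (a * mon t (ofColex M)) i =
      Finsupp.single (ofColex M) (coeffs C t a i 0) := by
  conv_lhs => rw [eq_sum_coeffs_of_mem_flat ht ha, Finset.sum_mul]
  have key : ∀ j, coeffs C t (coeffs C t a j 0 * mon t (ofColex M)) =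
      Pi.single j (Finsupp.single (ofColex M) (coeffs C t a j 0)) := by
    intro j
    by_cases h : coeffs C t a j 0 = 0
    · rw [h, zero_mul, coeffs_zero ht]; simp
    · exact coeffs_mul_mon ht ((isMatryoshka_coeffs ht a).isCoeff j 0) (ha j 0 h).2
  ext e
  change coeffHom ht i e (∑ j, _) = _
  rw [map_sum, Finset.sum_eq_single i]
  · change coeffs C t (_ * _) i e = _
    rw [key, Pi.single_eq_same]
  · intro j _ hj
    change coeffs C t (_ * _) i e = _
    rw [key, Pi.single_eq_of_ne hj.symm]
    rfl
  · simp

theorem totalCoeff_flat_mul_mon (ht : IsPrimitive D t) {M : Mono n} {a : K}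
    (ha : a ∈ flat ht M) (Q : Mono n) :
    totalCoeff ht Q (a * mon t (ofColex M)) = if Q = M then a else 0 := by
  rw [totalCoeff_apply]
  simp only [coeffs_flat_mul_mon ht ha, Finsupp.single_apply]
  split_ifs with h1 h2 h2
  · exact (eq_sum_coeffs_of_mem_flat ht ha).symm
  · exact absurd (ofColex.injective h1).symm h2
  · exact absurd (by rw [h2]) h1
  · simp

/-- The monomials that occur in the decomposition of `f`. -/
def monomials (C : Type*) {K : Type*} [Field C] [Field K] [Algebra C K] {n : ℕ}
    (t : Fin (n + 1) → K) (f : K) : Finset (Mono n) :=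
  Finset.univ.biUnion fun i => (coeffs C t f i).support.image toColex

theorem mem_monomials (ht : IsPrimitive D t) {f : K} {M : Mono n} :
    M ∈ monomials C t f ↔ totalCoeff ht M f ≠ 0 := by
  rw [Ne, totalCoeff_eq_zero_iff]
  push Not
  simp only [monomials, Finset.mem_biUnion, Finset.mem_univ, true_and, Finset.mem_image,
    Finsupp.mem_support_iff]
  refine exists_congr fun i => ?_
  constructor
  · rintro ⟨e, he, rfl⟩; exact he
  · exact fun h => ⟨_, h, rfl⟩

theorem eq_sum_totalCoeff (ht : IsPrimitive D t) (f : K) :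
    f = ∑ M ∈ monomials C t f, totalCoeff ht M f * mon t (ofColex M) := by
  conv_lhs => rw [(isMatryoshka_coeffs ht f).sum_eq]
  simp only [totalCoeff_apply, Finset.sum_mul]
  rw [Finset.sum_comm]
  refine Finset.sum_congr rfl fun i _ => ?_
  unfold evalMon Finsupp.sum
  trans ∑ M ∈ (coeffs C t f i).support.image (toColex : _ → Mono n),
    coeffs C t f i (ofColex M) * mon t (ofColex M)
  · rw [Finset.sum_image toColex.injective.injOn]
    rfl
  refine Finset.sum_subset (Finset.subset_biUnion_of_mem
    (fun i => (coeffs C t f i).support.image toColex) (Finset.mem_univ i)) ?_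
  intro M _ hM
  have : coeffs C t f i (ofColex M) = 0 := by
    by_contra h
    exact hM (Finset.mem_image.2 ⟨_, Finsupp.mem_support_iff.2 h, rfl⟩)
  rw [this, zero_mul]

end Coeffs

/-! ### Indicators of monomials -/

section Mono

variable {n : ℕ}

theorem ind_le {M : Mono n} {j : Fin (n + 1)} (h : M j ≠ 0) : ind M ≤ j :=
  Finset.inf_le (f := id) (Finset.mem_filter.2 ⟨Finset.mem_univ j, h⟩)

theorem le_ind {M : Mono n} {i : Fin (n + 1)} (h : ∀ j, M j ≠ 0 → i ≤ j) : i ≤ ind M :=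
  Finset.le_inf fun j hj => h j (Finset.mem_filter.1 hj).2

theorem apply_eq_zero_of_lt_ind {M : Mono n} {j : Fin (n + 1)} (h : j < ind M) : M j = 0 := by
  by_contra h1
  exact absurd (ind_le h1) (not_le.2 h)

theorem inT_of_lt_ind {M : Mono n} {i : Fin (n + 1)} (h : i < ind M) : InT i (ofColex M) :=
  fun _ hj => apply_eq_zero_of_lt_ind (lt_of_le_of_lt hj h)

theorem apply_ind_ne_zero {M : Mono n} (h : M ≠ toColex 0) : M (ind M) ≠ 0 := by
  obtain ⟨j, hj⟩ : ∃ j, M j ≠ 0 := by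
    by_contra hcon
    push Not at hcon
    exact h (ofColex.injective (funext hcon))
  have hne : (Finset.univ.filter fun j => M j ≠ 0).Nonempty :=
    ⟨j, Finset.mem_filter.2 ⟨Finset.mem_univ j, hj⟩⟩
  obtain ⟨k, hk, hk'⟩ := Finset.exists_mem_eq_inf _ hne id
  rw [ind, hk']
  exact (Finset.mem_filter.1 hk).2

theorem ind_toColex_zero : ind (toColex 0 : Mono n) = Fin.last n :=
  top_le_iff.1 (le_ind fun _ h => absurd rfl h)

theorem lt_ind_of_inT {M : Mono n} {i : Fin (n + 1)} (h : InT i (ofColex M))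
    (hM : i ≠ Fin.last n ∨ M ≠ toColex 0) : i < ind M := by
  by_cases h0 : M = toColex 0
  · rw [h0, ind_toColex_zero]
    exact lt_of_le_of_ne (Fin.le_last i) (hM.resolve_right (not_not.2 h0))
  · by_contra hle
    exact apply_ind_ne_zero h0 (h _ (not_lt.1 hle))

theorem zero_le_mono (M : Mono n) : toColex 0 ≤ M :=
  Pi.toColex_monotone fun _ => Nat.zero_le _

theorem lt_mono_of {M Q : Mono n} (j : Fin (n + 1)) (h : M j < Q j)
    (h' : ∀ l, j < l → M l = Q l) : M < Q :=
  ⟨j, h', h⟩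

/-- The monomial `M / t_m` with `m = ind M`. It is the largest monomial that can occur in the
derivative of `M`. -/
def lowerMono (M : Mono n) : Mono n := toColex (ofColex M - Pi.single (ind M) 1)

theorem lowerMono_add {M : Mono n} (h : M ≠ toColex 0) :
    ofColex (lowerMono M) + Pi.single (ind M) 1 = ofColex M := by
  ext j
  have h1 := apply_ind_ne_zero h
  rcases eq_or_ne j (ind M) with rfl | hj
  · have : M (ind M) = ofColex M (ind M) := rfl
    simp only [lowerMono, ofColex_toColex, Pi.add_apply, Pi.sub_apply, Pi.single_eq_same]
    omega
  · simp [lowerMono, Pi.single_eq_of_ne hj]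

theorem lowerMono_lt {M : Mono n} (h : M ≠ toColex 0) : lowerMono M < M := by
  have h1 := lowerMono_add h
  refine lt_mono_of (ind M) ?_ fun l hl => ?_
  · have := congrFun h1 (ind M)
    rw [Pi.add_apply, Pi.single_eq_same] at this
    change ofColex (lowerMono M) _ < ofColex M _
    omega
  · have := congrFun h1 l
    rwa [Pi.add_apply, Pi.single_eq_of_ne hl.ne', add_zero] at this

theorem ind_le_ind_lowerMono (M : Mono n) : ind M ≤ ind (lowerMono M) := by
  refine le_ind fun j hj => ind_le fun h => hj ?_
  change ofColex M j = 0 at h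
  simp [lowerMono, h]

/-- Between `M / t_m` and `M`, where `m = ind M`, the map `Q ↦ Q / t_{ind Q}` is bounded below by
`M / t_m`. -/
theorem lowerMono_le_of_lt {M Q : Mono n} (hQ : Q ≠ toColex 0) (h1 : lowerMono M < Q)
    (h2 : Q < M) : lowerMono M ≤ lowerMono Q := by
  have hM : M ≠ toColex 0 := fun h => absurd (h ▸ h2) (not_lt.2 (zero_le_mono Q))
  have hadd := lowerMono_add hM
  obtain ⟨j, hj, hlt⟩ := h1
  obtain ⟨k, hk, hlt'⟩ := h2
  change ∀ l, j < l → ofColex (lowerMono M) l = ofColex Q l at hj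
  change ∀ l, k < l → ofColex Q l = ofColex M l at hk
  change ofColex (lowerMono M) j < ofColex Q j at hlt
  change ofColex Q k < ofColex M k at hlt'
  have hval : ∀ l, l ≠ ind M → ofColex (lowerMono M) l = ofColex M l := fun l hl => by
    have := congrFun hadd l
    rwa [Pi.add_apply, Pi.single_eq_of_ne hl, add_zero] at this
  have hval' : ofColex (lowerMono M) (ind M) + 1 = ofColex M (ind M) := by
    have := congrFun hadd (ind M)
    rwa [Pi.add_apply, Pi.single_eq_same] at this
  -- the exponent of `t_m` is the first one where `Q` and `M` differ
  have hki : k = ind M := by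
    by_contra hne
    rcases lt_trichotomy j k with h | h | h
    · have := hj k h; rw [hval k hne] at this; omega
    · subst h; rw [hval j hne] at hlt; omega
    · have h3 := hk j h
      rcases eq_or_ne j (ind M) with rfl | h4
      · exact absurd (apply_eq_zero_of_lt_ind h : ofColex M k = 0) (by omega)
      · rw [hval j h4] at hlt; omega
  subst hki
  have hji : j < ind M := by
    rcases lt_trichotomy j (ind M) with h | h | h
    · exact h
    · rw [h] at hlt; omega
    · have h3 := hk j h; rw [hval j h.ne'] at hlt; omega
  have hind : ind Q ≤ j := ind_le (by change ofColex Q j ≠ 0; omega)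
  have haddQ := lowerMono_add hQ
  have hvalQ : ∀ l, l ≠ ind Q → ofColex (lowerMono Q) l = ofColex Q l := fun l hl => by
    have := congrFun haddQ l
    rwa [Pi.add_apply, Pi.single_eq_of_ne hl, add_zero] at this
  refine Pi.toColex_monotone (a := ofColex (lowerMono M)) (b := ofColex (lowerMono Q)) fun l => ?_
  rcases lt_or_ge l (ind M) with h | h
  · rw [hval l h.ne, show ofColex M l = 0 from apply_eq_zero_of_lt_ind h]
    exact Nat.zero_le _
  · rw [hvalQ l (hind.trans_lt (hji.trans_le h)).ne', hj l (hji.trans_le h)]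

end Mono

/-! ### Leading terms of derivatives -/

section Deriv

variable {C K : Type*} [Field C] [Field K] [Algebra C K] {n : ℕ}
  {D : Derivation C K K} {t : Fin (n + 1) → K}

theorem deriv_mon (ht : IsPrimitive D t) (e : Fin (n + 1) → ℕ) :
    D (mon t e) = ∑ j, (e j : K) * D (t j) * mon t (e - Pi.single j 1) := by
  have ht0 : ∀ j, t j ≠ 0 := fun j h => by
    have := ht.transcendental j
    rw [h] at this
    exact this isAlgebraic_zero
  have key : ∀ s : Finset (Fin (n + 1)), D (∏ j ∈ s, t j ^ e j) =
      (∏ j ∈ s, t j ^ e j) * ∑ j ∈ s, (e j : K) * D (t j) / t j := by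
    intro s
    induction s using Finset.induction_on with
    | empty => simp
    | insert k s hk ih =>
      rw [Finset.prod_insert hk, Finset.sum_insert hk, Derivation.leibniz, ih,
        Derivation.leibniz_pow]
      have h1 : ((e k : K) * t k ^ (e k - 1)) = t k ^ e k * (e k / t k) := by
        have := ht0 k
        rcases Nat.eq_zero_or_pos (e k) with h | h
        · simp [h]
        · obtain ⟨m, hm⟩ := Nat.exists_eq_add_of_lt h
          rw [hm]
          simp only [zero_add, Nat.add_sub_cancel, pow_succ]
          field_simp
      simp only [smul_eq_mul, nsmul_eq_mul]
      linear_combination (D (t k) * ∏ j ∈ s, t j ^ e j) * h1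
  rw [mon, key, Finset.mul_sum]
  refine Finset.sum_congr rfl fun j _ => ?_
  have := ht0 j
  rcases Nat.eq_zero_or_pos (e j) with h | h
  · simp [h]
  · have h1 : mon t e = mon t (e - Pi.single j 1) * t j := by
      conv_rhs => rw [← pow_one (t j), ← mon_single, ← mon_add]
      congr 1
      ext l
      rcases eq_or_ne l j with rfl | hl
      · simp; omega
      · simp [Pi.single_eq_of_ne hl]
    rw [← mon, h1]
    field_simp

/-- `(a M)' = a' M` up to terms with lower monomials, which lie outside of `P_n`. -/
theorem deriv_flat_mul_mon (ht : IsPrimitive D t) {M : Mono n} {a : K} (ha : a ∈ flat ht M) :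
    D (a * mon t (ofColex M)) - D a * mon t (ofColex M) ∈
      suppIn ht fun i e => i < Fin.last n ∧ toColex e < M := by
  rw [Derivation.leibniz, smul_eq_mul, smul_eq_mul, mul_comm _ (D a), add_sub_cancel_right,
    deriv_mon ht]
  nth_rewrite 1 [eq_sum_coeffs_of_mem_flat ht ha]
  rw [Finset.sum_mul_sum]
  refine sum_mem fun i _ => sum_mem fun j _ => ?_
  by_cases h : coeffs C t a i 0 = 0
  · rw [h, zero_mul]; exact zero_mem _
  by_cases hj0 : ofColex M j = 0
  · rw [hj0]; simp [zero_mem]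
  have hij : i < j := by
    by_contra hle
    exact hj0 ((ha i 0 h).2 j (not_lt.1 hle))
  have hmem : coeffs C t a i 0 * ((ofColex M j : K) * D (t j)) ∈ below C t j :=
    mul_mem (upto_le_below t hij ((isMatryoshka_coeffs ht a).isCoeff i 0).mem_upto)
      (mul_mem (natCast_mem _ _) (ht.deriv_gen_mem j))
  rw [← mul_assoc]
  refine suppIn_mono ht ?_ (mul_mon_mem_suppIn_of_mem_below ht
    (lt_of_le_of_lt (Fin.zero_le i) hij) hmem (ofColex M - Pi.single j 1))
  rintro k e ⟨hk, he⟩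
  refine ⟨hk.trans_le (Fin.le_last j), lt_mono_of j ?_ fun l hl => ?_⟩
  · change e j < ofColex M j
    rw [he j le_rfl, Pi.sub_apply, Pi.single_eq_same]
    omega
  · change e l = ofColex M l
    rw [he l hl.le, Pi.sub_apply, Pi.single_eq_of_ne hl.ne', Nat.sub_zero]

theorem totalCoeff_deriv_of_lt (ht : IsPrimitive D t) {M Q : Mono n} {a : K}
    (ha : a ∈ flat ht M) (h : M < Q) : totalCoeff ht Q (D (a * mon t (ofColex M))) = 0 := by
  have h1 := deriv_flat_mul_mon ht ha
  have h2 := totalCoeff_eq_zero ht h1 (M := Q) fun i hi => absurd (hi.2.trans h) (lt_irrefl _)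
  rw [map_sub, totalCoeff_flat_mul_mon ht (deriv_mem_flat ht ha), if_neg h.ne', sub_zero] at h2
  exact h2

theorem totalCoeff_deriv_self (ht : IsPrimitive D t) {M : Mono n} {a : K}
    (ha : a ∈ flat ht M) : totalCoeff ht M (D (a * mon t (ofColex M))) = D a := by
  have h1 := deriv_flat_mul_mon ht ha
  have h2 := totalCoeff_eq_zero ht h1 (M := M) fun i hi => absurd hi.2 (lt_irrefl _)
  rwa [map_sub, totalCoeff_flat_mul_mon ht (deriv_mem_flat ht ha), if_pos rfl, sub_eq_zero] at h2

theorem isCoeff_of_mem_bot {c : K} (hc : c ∈ (⊥ : IntermediateField C K)) :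
    IsCoeff C t 0 c := Or.inl ⟨rfl, (bot_le : ⊥ ≤ upto C t 0) hc⟩

/-! ### Simple elements of the tower -/

theorem coeffs_proj (ht : IsPrimitive D t) (i : Fin (n + 1)) (f : K) :
    coeffs C t (proj C t i f) = Pi.single i (coeffs C t f i) := by
  have hm := isMatryoshka_coeffs ht f
  refine coeffs_eq ht ⟨?_, ?_, ?_⟩
  · intro j e hj
    rcases eq_or_ne j i with rfl | hji
    · rw [Pi.single_eq_same] at hj
      exact hm.inT j e hj
    · simp [Pi.single_eq_of_ne hji] at hj
  · intro j e
    rcases eq_or_ne j i with rfl | hji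
    · rw [Pi.single_eq_same]
      exact hm.isCoeff j e
    · rw [Pi.single_eq_of_ne hji]
      exact .of_zero
  · rw [Finset.sum_eq_single i]
    · rw [Pi.single_eq_same]; rfl
    · intro j _ hji
      simp [Pi.single_eq_of_ne hji, evalMon]
    · simp

theorem proj_add (ht : IsPrimitive D t) (i : Fin (n + 1)) (f g : K) :
    proj C t i (f + g) = proj C t i f + proj C t i g := by
  rw [proj, proj, proj, coeffs_add ht]
  exact Finsupp.sum_add_index' (fun _ => zero_mul _) fun _ _ _ => add_mul _ _ _

theorem proj_sub (ht : IsPrimitive D t) (i : Fin (n + 1)) (f g : K) :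
    proj C t i (f - g) = proj C t i f - proj C t i g := by
  rw [proj, proj, proj, coeffs_sub ht]
  exact evalMon_sub _ _ _

theorem coeffs_smul (ht : IsPrimitive D t) (c : C) (f : K) (i : Fin (n + 1))
    (e : Fin (n + 1) → ℕ) : coeffs C t (c • f) i e = c • coeffs C t f i e := by
  have hc : ∀ j, algebraMap C K c ∈ upto C t j := fun j => (upto C t j).algebraMap_mem c
  have hm := isMatryoshka_coeffs ht f
  rw [coeffs_eq ht (c := fun i => c • coeffs C t f i) ⟨?_, ?_, ?_⟩]
  · rfl
  · intro i e h
    refine hm.inT i e fun h0 => h ?_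
    simp [h0]
  · intro i e
    rcases hm.isCoeff i e with ⟨h0, h⟩ | ⟨h0, p, q, hpq, h⟩
    · refine Or.inl ⟨h0, ?_⟩
      rw [Finsupp.smul_apply, Algebra.smul_def]
      exact mul_mem (hc _) h
    · refine Or.inr ⟨h0, Polynomial.C (algebraMap C (below C t i) c) * p, q,
        (Polynomial.degree_mul_le _ _).trans_lt ((add_le_add_left Polynomial.degree_C_le _).trans_lt
          (by rwa [zero_add])), ?_⟩
      rw [Finsupp.smul_apply, h, map_mul, Polynomial.aeval_C, mul_div_assoc, Algebra.smul_def]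
      rfl
  · conv_lhs => rw [hm.sum_eq, Finset.smul_sum]
    refine Finset.sum_congr rfl fun i _ => ?_
    unfold evalMon
    rw [Finsupp.smul_sum, Finsupp.sum_smul_index' (fun _ => zero_mul _)]
    simp only [smul_mul_assoc]

theorem proj_smul (ht : IsPrimitive D t) (c : C) (i : Fin (n + 1)) (f : K) :
    proj C t i (c • f) = c • proj C t i f := by
  have h : coeffs C t (c • f) i = c • coeffs C t f i := Finsupp.ext fun e => coeffs_smul ht c f i e
  rw [proj, proj, h, evalMon, evalMon, Finsupp.smul_sum,
    Finsupp.sum_smul_index' (fun _ => zero_mul _)]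
  simp only [smul_mul_assoc]

theorem proj_zero (ht : IsPrimitive D t) (i : Fin (n + 1)) : proj C t i (0 : K) = 0 := by
  rw [proj, coeffs_zero ht]; rfl

/-- The simple elements form a vector space over `C`. -/
def simpleSubmodule [CharZero C] (ht : IsPrimitive D t) : Submodule C K where
  carrier := {f | IsSimple D t f}
  zero_mem' i := by rw [proj_zero ht]; exact .zero ht
  add_mem' hf hg i := by rw [proj_add ht]; exact (hf i).add ht (hg i)
  smul_mem' c f hf i := by rw [proj_smul ht]; exact (hf i).smul ht c

theorem proj_eq_of_suppIn {f : K} {i : Fin (n + 1)}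
    (hf : ∀ e, coeffs C t f i e ≠ 0 → e = 0) : proj C t i f = coeffs C t f i 0 := by
  unfold proj evalMon Finsupp.sum
  rw [Finset.sum_eq_single 0]
  · simp [mon_zero]
  · intro e he h0
    exact absurd (hf e (Finsupp.mem_support_iff.1 he)) h0
  · intro h0
    simp [Finsupp.notMem_support_iff.1 h0]

/-- Simple elements involve no monomial other than `1`. -/
theorem coeffs_of_isSimpleAt (ht : IsPrimitive D t) {f : K} {i : Fin (n + 1)}
    (hf : IsSimpleAt D t i (proj C t i f)) :
    coeffs C t f i = Finsupp.single 0 (proj C t i f) := by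
  have h1 := coeffs_proj ht i f
  rw [coeffs_of_isCoeff ht hf.isProper.isCoeff] at h1
  have := congrFun h1 i
  rw [Pi.single_eq_same, Pi.single_eq_same] at this
  exact this.symm

theorem isSimple_of_mem_flat (ht : IsPrimitive D t) {M : Mono n} {a : K} (ha : a ∈ flat ht M) :
    IsSimple D t a ↔ ∀ i, IsSimpleAt D t i (coeffs C t a i 0) := by
  refine forall_congr' fun i => ?_
  rw [proj_eq_of_suppIn fun e he => (ha i e he).1]

/-- The derivative of a flat element is not simple unless it is `0`. -/
theorem deriv_eq_zero_of_isSimple [CharZero C] (ht : IsPrimitive D t) {M : Mono n} {b : K}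
    (hb : b ∈ flat ht M) (hs : IsSimple D t (D b)) : D b = 0 := by
  rw [eq_sum_coeffs_of_mem_flat ht hb, map_sum]
  refine Finset.sum_eq_zero fun i _ => ?_
  have h1 := (isSimple_of_mem_flat ht (deriv_mem_flat ht hb)).1 hs i
  rw [coeffs_deriv_of_mem_flat ht hb, Finsupp.single_eq_same] at h1
  exact deriv_eq_zero_of_simple ht ((isMatryoshka_coeffs ht b).isCoeff i 0).mem_upto h1

end Deriv

/-! ### Derivatives in an S-primitive tower -/

section SPrimitive

variable {C K : Type*} [Field C] [Field K] [Algebra C K] {n : ℕ}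
  {D : Derivation C K K} {t : Fin (n + 1) → K}

theorem smul_mem_flat (ht : IsPrimitive D t) {M : Mono n} {a : K} (c : C)
    (ha : a ∈ flat ht M) : c • a ∈ flat ht M := by
  intro i e h
  refine ha i e fun h0 => h ?_
  rw [coeffs_smul ht, h0, smul_zero]

/-- As `t_k'` is simple, it is flat. -/
theorem deriv_gen_mem_flat (hs : IsSPrimitive D t) {M : Mono n} {k : Fin (n + 1)} (hk : 0 < k)
    (hkM : k ≤ ind M) : D (t k) ∈ flat hs.toIsPrimitive M := by
  have ht := hs.toIsPrimitive
  intro i e h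
  have h1 := mul_mon_mem_suppIn_of_mem_below ht hk (ht.deriv_gen_mem k) 0
  rw [mon_zero, mul_one] at h1
  refine ⟨?_, inT_of_lt_ind ((h1 i e h).1.trans_le hkM)⟩
  rw [coeffs_of_isSimpleAt ht (hs.simple k hk i), Finsupp.single_apply] at h
  by_contra hne
  exact h (if_neg (Ne.symm hne))

/-- The derivative of `c M`, with a constant `c`, is `c d t_m' M / t_m` up to lower terms, where
`m = ind M` and `d` is the exponent of `t_m` in `M`. -/
theorem deriv_smul_mon (hs : IsSPrimitive D t) {M : Mono n} (h0 : 0 < ind M) (c : C) :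
    D (c • mon t (ofColex M)) -
        ((c * (M (ind M) : C)) • D (t (ind M))) * mon t (ofColex (lowerMono M)) ∈
      suppIn hs.toIsPrimitive fun _ e => toColex e < lowerMono M := by
  have ht := hs.toIsPrimitive
  have hcast : ∀ m : ℕ, algebraMap C K (m : C) = (m : K) := fun m => map_natCast _ m
  have hsum : D (c • mon t (ofColex M)) =
      ∑ j, (algebraMap C K c * ((ofColex M j : K) * D (t j))) *
        mon t (ofColex M - Pi.single j 1) := by
    rw [D.map_smul, deriv_mon ht, Finset.smul_sum]
    exact Finset.sum_congr rfl fun j _ => by rw [Algebra.smul_def]; ring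
  rw [hsum, ← Finset.add_sum_erase _ _ (Finset.mem_univ (ind M))]
  have hmain : (algebraMap C K c * ((ofColex M (ind M) : K) * D (t (ind M)))) *
      mon t (ofColex M - Pi.single (ind M) 1) =
      ((c * (M (ind M) : C)) • D (t (ind M))) * mon t (ofColex (lowerMono M)) := by
    rw [Algebra.smul_def, map_mul, hcast, ← mul_assoc (algebraMap C K c)]
    rfl
  rw [hmain, add_sub_cancel_left]
  refine sum_mem fun j hj => ?_
  have hj := Finset.ne_of_mem_erase hj
  by_cases hj0 : ofColex M j = 0
  · rw [hj0]; simp [zero_mem]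
  have hlt : ind M < j := lt_of_le_of_ne (ind_le hj0) hj.symm
  have hmem : algebraMap C K c * ((ofColex M j : K) * D (t j)) ∈ below C t j :=
    mul_mem ((below C t j).algebraMap_mem c) (mul_mem (natCast_mem _ _) (ht.deriv_gen_mem j))
  refine suppIn_mono ht ?_ (mul_mon_mem_suppIn_of_mem_below ht (h0.trans hlt) hmem
    (ofColex M - Pi.single j 1))
  rintro k e ⟨-, he⟩
  refine lt_mono_of j ?_ fun l hl => ?_
  · change e j < ofColex M j - Pi.single (M := fun _ => ℕ) (ind M) 1 j
    rw [he j le_rfl, Pi.sub_apply, Pi.single_eq_same, Pi.single_eq_of_ne hj]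
    omega
  · change e l = ofColex M l - Pi.single (M := fun _ => ℕ) (ind M) 1 l
    rw [he l hl.le, Pi.sub_apply, Pi.single_eq_of_ne hl.ne', Pi.single_eq_of_ne (hlt.trans hl).ne']

theorem totalCoeff_deriv_smul_mon (hs : IsSPrimitive D t) {M W : Mono n}
    (h0 : 0 < ind M) (c : C) (hW : lowerMono M ≤ W) :
    totalCoeff hs.toIsPrimitive W (D (c • mon t (ofColex M))) =
      if lowerMono M = W then (c * (M (ind M) : C)) • D (t (ind M)) else 0 := by
  have ht := hs.toIsPrimitive
  have h1 := totalCoeff_eq_zero ht (deriv_smul_mon hs h0 c) (M := W)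
    fun _ h => absurd (lt_of_lt_of_le h hW) (lt_irrefl _)
  rw [map_sub, sub_eq_zero] at h1
  rw [h1, totalCoeff_flat_mul_mon ht
    (smul_mem_flat ht _ (deriv_gen_mem_flat hs h0 (ind_le_ind_lowerMono M)))]
  exact if_congr eq_comm rfl rfl

/-- Above `W` all coefficients of `u` are constants, and derivatives of the monomials of `u`
above `W` do not involve monomials above `W`. -/
def ConstantAbove (ht : IsPrimitive D t) (W : Mono n) (u : K) : Prop :=
  ∀ Q, W < Q → totalCoeff ht Q u ≠ 0 →
    totalCoeff ht Q u ∈ (⊥ : IntermediateField C K) ∧ lowerMono Q ≤ W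

theorem ind_pos_of_totalCoeff_ne_zero (ht : IsPrimitive D t) {Q : Mono n} (hQ : Q ≠ toColex 0)
    {u : K} (h : totalCoeff ht Q u ≠ 0) : 0 < ind Q := by
  obtain ⟨i, hi⟩ : ∃ i, coeffs C t u i (ofColex Q) ≠ 0 := by
    by_contra hcon
    push Not at hcon
    exact h ((totalCoeff_eq_zero_iff ht).2 hcon)
  exact lt_of_le_of_lt (Fin.zero_le i)
    (lt_ind_of_inT ((isMatryoshka_coeffs ht u).inT i _ hi) (Or.inr hQ))

/-- The monomials of `u` above `W` whose derivatives involve `W`. -/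
def contributors (C : Type*) {K : Type*} [Field C] [Field K] [Algebra C K] {n : ℕ}
    (t : Fin (n + 1) → K) (W : Mono n) (u : K) : Finset (Mono n) :=
  (monomials C t u).filter fun Q => W < Q ∧ lowerMono Q = W

/-- The sum of the coefficient of `W` in `u` and of the `c d t_k`, where `c` is the coefficient in
`u` of a contributing monomial `W t_k` and `d` is the exponent of `t_k` in it. If `ConstantAbove`
holds at `W`, then its derivative is the coefficient of `W` in `u'`, see `totalCoeff_deriv`. -/
def antiderivAt (ht : IsPrimitive D t) (W : Mono n) (u : K) : K :=
  totalCoeff ht W u +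
    ∑ Q ∈ contributors C t W u, totalCoeff ht Q u * (Q (ind Q) : K) * t (ind Q)

theorem deriv_antiderivAt (ht : IsPrimitive D t) {W : Mono n} {u : K}
    (h : ConstantAbove ht W u) : D (antiderivAt ht W u) = D (totalCoeff ht W u) +
      ∑ Q ∈ contributors C t W u, totalCoeff ht Q u * (Q (ind Q) : K) * D (t (ind Q)) := by
  rw [antiderivAt, map_add, map_sum]
  congr 1
  refine Finset.sum_congr rfl fun Q hQ => ?_
  simp only [contributors, Finset.mem_filter, mem_monomials ht] at hQ
  have h1 := deriv_eq_zero_of_mem_bot (D := D)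
    (mul_mem (h Q hQ.2.1 hQ.1).1 (natCast_mem _ (Q (ind Q))))
  rw [Derivation.leibniz, h1, smul_zero, add_zero, smul_eq_mul]

theorem totalCoeff_deriv (hs : IsSPrimitive D t) {W : Mono n} {u : K}
    (h : ConstantAbove hs.toIsPrimitive W u) :
    totalCoeff hs.toIsPrimitive W (D u) = D (antiderivAt hs.toIsPrimitive W u) := by
  have ht := hs.toIsPrimitive
  have hterm : ∀ Q, totalCoeff ht W (D (totalCoeff ht Q u * mon t (ofColex Q))) =
      (if Q = W then D (totalCoeff ht W u) else 0) + if W < Q ∧ lowerMono Q = W then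
        totalCoeff ht Q u * (Q (ind Q) : K) * D (t (ind Q)) else 0 := by
    intro Q
    rcases lt_trichotomy Q W with hQ | rfl | hQ
    · rw [totalCoeff_deriv_of_lt ht (totalCoeff_mem_flat ht Q u) hQ, if_neg hQ.ne,
        if_neg fun h => absurd (h.1.trans hQ) (lt_irrefl _), add_zero]
    · rw [totalCoeff_deriv_self ht (totalCoeff_mem_flat ht Q u), if_pos rfl,
        if_neg fun h => absurd h.1 (lt_irrefl _), add_zero]
    · rw [if_neg hQ.ne', zero_add]
      by_cases h0 : totalCoeff ht Q u = 0
      · simp [h0]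
      have hQ0 : Q ≠ toColex 0 := ne_of_gt (lt_of_le_of_lt (zero_le_mono W) hQ)
      obtain ⟨hc, hle⟩ := h Q hQ h0
      obtain ⟨c, hc⟩ := IntermediateField.mem_bot.1 hc
      rw [← hc, ← Algebra.smul_def, totalCoeff_deriv_smul_mon hs
        (ind_pos_of_totalCoeff_ne_zero ht hQ0 h0) c hle, Algebra.smul_def, map_mul, map_natCast]
      by_cases hg : lowerMono Q = W
      · rw [if_pos hg, if_pos ⟨hQ, hg⟩]
      · rw [if_neg hg, if_neg fun h => hg h.2]
  conv_lhs => rw [eq_sum_totalCoeff ht u]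
  rw [map_sum, map_sum, Finset.sum_congr rfl fun Q _ => hterm Q, Finset.sum_add_distrib,
    deriv_antiderivAt ht h, contributors, Finset.sum_filter, Finset.sum_ite_eq']
  congr 1
  split_ifs with hW
  · rfl
  · rw [mem_monomials ht, not_not] at hW
    rw [hW, map_zero]

theorem totalCoeff_single_mul_gen (ht : IsPrimitive D t) {c : K}
    (hc : c ∈ (⊥ : IntermediateField C K)) {k l : Fin (n + 1)} (hk : 0 < k) :
    totalCoeff ht (toColex (Pi.single l 1)) (c * t k) = if l = k then c else 0 := by
  have h := totalCoeff_mul_mon ht (isCoeff_of_mem_bot (t := t) hc) (e := Pi.single k 1)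
    (fun j hj => by
      rw [Pi.single_eq_of_ne]
      exact (lt_of_le_of_lt hj hk).ne) (toColex (Pi.single l 1))
  rw [mon_single, pow_one] at h
  rw [h]
  refine if_congr ⟨fun h => ?_, fun h => by rw [h]; rfl⟩ rfl rfl
  by_contra hne
  have := congrFun h l
  simp [Pi.single_eq_of_ne hne] at this

theorem totalCoeff_single_of_mem_flat (ht : IsPrimitive D t) {M : Mono n} {a : K}
    (ha : a ∈ flat ht M) (l : Fin (n + 1)) :
    totalCoeff ht (toColex (Pi.single l 1)) a = 0 := by
  refine totalCoeff_eq_zero ht ha fun i h => ?_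
  have := congrFun h.1 l
  simp at this

/-- If the coefficient of `W` in `u'` vanishes, then no monomial of `u` above `W` contributes to
it: otherwise `antiderivAt` would be a constant in which some `t_k` occurs. -/
theorem contributors_eq_empty [CharZero C] (hs : IsSPrimitive D t) {W : Mono n} {u : K}
    (h : ConstantAbove hs.toIsPrimitive W u)
    (h0 : totalCoeff hs.toIsPrimitive W (D u) = 0) :
    totalCoeff hs.toIsPrimitive W u ∈ (⊥ : IntermediateField C K) ∧
      contributors C t W u = ∅ := by
  have ht := hs.toIsPrimitive
  have : CharZero K := charZero_of_injective_algebraMap (algebraMap C K).injective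
  rw [totalCoeff_deriv hs h] at h0
  have hv := mem_bot_of_deriv_eq_zero ht h0
  have hempty : contributors C t W u = ∅ := by
    by_contra hne
    obtain ⟨Q, hQ⟩ := Finset.nonempty_iff_ne_empty.2 hne
    have hprop : ∀ Q ∈ contributors C t W u, W < Q ∧ lowerMono Q = W ∧ totalCoeff ht Q u ≠ 0 ∧
        Q ≠ toColex 0 := by
      intro Q hQ
      simp only [contributors, Finset.mem_filter, mem_monomials ht] at hQ
      exact ⟨hQ.2.1, hQ.2.2, hQ.1, ne_of_gt (lt_of_le_of_lt (zero_le_mono W) hQ.2.1)⟩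
    have h1 : totalCoeff ht (toColex (Pi.single (ind Q) 1)) (antiderivAt ht W u) = 0 :=
      totalCoeff_single_of_mem_flat ht (M := toColex 0)
        (mem_flat_of_isCoeff ht (isCoeff_of_mem_bot hv) fun _ _ => rfl) _
    rw [antiderivAt, map_add, totalCoeff_single_of_mem_flat ht (totalCoeff_mem_flat ht W u),
      zero_add, map_sum, Finset.sum_eq_single Q] at h1
    · obtain ⟨hlt, hg, hne0, hQ0⟩ := hprop Q hQ
      rw [totalCoeff_single_mul_gen ht (mul_mem (h Q hlt hne0).1 (natCast_mem _ _))
        (ind_pos_of_totalCoeff_ne_zero ht hQ0 hne0), if_pos rfl] at h1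
      rcases mul_eq_zero.1 h1 with h2 | h2
      · exact hne0 h2
      · exact apply_ind_ne_zero hQ0 (by exact_mod_cast h2)
    · intro R hR hRQ
      obtain ⟨hlt, hg, hne0, hR0⟩ := hprop R hR
      obtain ⟨-, hg', -, hQ0⟩ := hprop Q hQ
      rw [totalCoeff_single_mul_gen ht (mul_mem (h R hlt hne0).1 (natCast_mem _ _))
        (ind_pos_of_totalCoeff_ne_zero ht hR0 hne0), if_neg]
      intro hind
      apply hRQ
      rw [← ofColex_inj, ← lowerMono_add hR0, ← lowerMono_add hQ0, hg, hg', hind]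
    · exact fun h => absurd hQ h
  refine ⟨?_, hempty⟩
  rwa [antiderivAt, hempty, Finset.sum_empty, add_zero] at hv

/-- If no monomial above `M` occurs in `u'`, then `ConstantAbove` holds from `M` on. The proof goes
through the monomials of `u` from the top down: were `lowerMono Q > W` for the lowest monomial `Q`
of `u` above `W`, then `Q` would contribute to `lowerMono Q` in `u'`. -/
theorem constantAbove_of_totalCoeff_deriv [CharZero C] (hs : IsSPrimitive D t) {M : Mono n} {u : K}
    (h0 : ∀ Q, M < Q → totalCoeff hs.toIsPrimitive Q (D u) = 0) (m : ℕ) :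
    ∀ W, M ≤ W → ((monomials C t u).filter (W < ·)).card ≤ m →
      ConstantAbove hs.toIsPrimitive W u := by
  have ht := hs.toIsPrimitive
  induction m with
  | zero =>
    intro W _ hcard Q hQ hne
    have h1 := Finset.card_eq_zero.1 (Nat.le_zero.1 hcard)
    have h2 : Q ∈ (monomials C t u).filter (W < ·) :=
      Finset.mem_filter.2 ⟨(mem_monomials ht).2 hne, hQ⟩
    rw [h1] at h2
    simp at h2
  | succ m ih =>
    intro W hW hcard
    rcases Finset.eq_empty_or_nonempty ((monomials C t u).filter (W < ·)) with he | hne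
    · exact ih W hW (by rw [he]; simp)
    -- `Q` is the lowest monomial of `u` above `W`
    set Q := ((monomials C t u).filter (W < ·)).min' hne with hQdef
    have hQmem := Finset.min'_mem _ hne
    rw [← hQdef, Finset.mem_filter, mem_monomials ht] at hQmem
    have hmin : ∀ R, W < R → totalCoeff ht R u ≠ 0 → Q ≤ R := fun R hR hR0 =>
      Finset.min'_le _ _ (Finset.mem_filter.2 ⟨(mem_monomials ht).2 hR0, hR⟩)
    have hMQ : M < Q := lt_of_le_of_lt hW hQmem.2
    have hQ0 : Q ≠ toColex 0 := ne_of_gt (lt_of_le_of_lt (zero_le_mono M) hMQ)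
    have hlt := lowerMono_lt hQ0
    have hQconst : ConstantAbove ht Q u := by
      refine ih Q hMQ.le (Nat.le_of_lt_succ (lt_of_lt_of_le (Finset.card_lt_card ?_) hcard))
      refine Finset.ssubset_iff_subset_ne.2 ⟨fun R hR => ?_, fun heq => ?_⟩
      · rw [Finset.mem_filter] at hR ⊢
        exact ⟨hR.1, hQmem.2.trans hR.2⟩
      · have : Q ∈ (monomials C t u).filter (Q < ·) := by
          rw [heq]
          exact Finset.mem_filter.2 ⟨(mem_monomials ht).2 hQmem.1, hQmem.2⟩
        exact absurd (Finset.mem_filter.1 this).2 (lt_irrefl _)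
    obtain ⟨hbot, hempty⟩ := contributors_eq_empty hs hQconst (h0 Q hMQ)
    -- every monomial of `u` above `W` satisfies the claim with `lowerMono Q` in the place of `W`
    have hall : ∀ R, W < R → totalCoeff ht R u ≠ 0 →
        totalCoeff ht R u ∈ (⊥ : IntermediateField C K) ∧ lowerMono R ≤ lowerMono Q := by
      intro R hR hR0
      rcases (hmin R hR hR0).lt_or_eq with hQR | rfl
      · obtain ⟨h1, h2⟩ := hQconst R hQR hR0
        refine ⟨h1, lowerMono_le_of_lt hQ0 (lt_of_le_of_ne h2 fun heq => ?_) hQR⟩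
        have : R ∈ contributors C t Q u :=
          Finset.mem_filter.2 ⟨(mem_monomials ht).2 hR0, hQR, heq⟩
        rw [hempty] at this
        simp at this
      · exact ⟨hbot, le_rfl⟩
    rcases le_or_gt (lowerMono Q) W with hle | hgt
    · exact fun R hR hR0 => ⟨(hall R hR hR0).1, (hall R hR hR0).2.trans hle⟩
    · exfalso
      have hc : ConstantAbove ht (lowerMono Q) u := fun R hR hR0 => hall R (hgt.trans hR) hR0
      obtain ⟨-, he⟩ := contributors_eq_empty hs hc (h0 _ (lt_of_le_of_lt hW hgt))
      have : Q ∈ contributors C t (lowerMono Q) u :=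
        Finset.mem_filter.2 ⟨(mem_monomials ht).2 hQmem.1, hlt, rfl⟩
      rw [he] at this
      simp at this

theorem derivSpan_le_simple [CharZero C] (hs : IsSPrimitive D t) (m : Fin (n + 1)) :
    derivSpan D t m ≤ simpleSubmodule hs.toIsPrimitive := by
  refine Submodule.span_le.2 ?_
  rintro y ⟨j, hj, -, rfl⟩
  exact hs.simple j hj

/-- If the coefficient `a` of the highest monomial `M` in a derivative is simple, then `a` is a
linear combination of `t_1', …, t_m'`, where `m = ind M`. -/
theorem mem_derivSpan_of_isSimple [CharZero C] (hs : IsSPrimitive D t) {M : Mono n} {u : K}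
    (h0 : ∀ Q, M < Q → totalCoeff hs.toIsPrimitive Q (D u) = 0)
    (hM : IsSimple D t (totalCoeff hs.toIsPrimitive M (D u))) :
    totalCoeff hs.toIsPrimitive M (D u) ∈ derivSpan D t (ind M) := by
  have ht := hs.toIsPrimitive
  have hc := constantAbove_of_totalCoeff_deriv hs h0 _ M le_rfl le_rfl
  rw [totalCoeff_deriv hs hc, deriv_antiderivAt ht hc] at hM ⊢
  have hz : ∑ Q ∈ contributors C t M u, totalCoeff ht Q u * (Q (ind Q) : K) * D (t (ind Q)) ∈
      derivSpan D t (ind M) := by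
    refine sum_mem fun Q hQ => ?_
    simp only [contributors, Finset.mem_filter, mem_monomials ht] at hQ
    obtain ⟨hne, hlt, hg⟩ := hQ
    have hQ0 : Q ≠ toColex 0 := ne_of_gt (lt_of_le_of_lt (zero_le_mono M) hlt)
    obtain ⟨c, hc⟩ := IntermediateField.mem_bot.1
      (mul_mem (hc Q hlt hne).1 (natCast_mem _ (Q (ind Q))))
    rw [← hc, ← Algebra.smul_def]
    refine Submodule.smul_mem _ _ (Submodule.subset_span ⟨ind Q,
      ind_pos_of_totalCoeff_ne_zero ht hQ0 hne, ?_, rfl⟩)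
    rw [← hg]
    exact ind_le_ind_lowerMono Q
  have hD : D (totalCoeff ht M u) = 0 := by
    refine deriv_eq_zero_of_isSimple ht (totalCoeff_mem_flat ht M u) ?_
    have h1 := sub_mem (show _ ∈ simpleSubmodule ht from hM) (derivSpan_le_simple hs _ hz)
    rwa [add_sub_cancel_right] at h1
  rwa [hD, zero_add]

end SPrimitive

/-! ### Head monomials and head coefficients -/

section Head

variable {C K : Type*} [Field C] [Field K] [Algebra C K] {n : ℕ}
  {D : Derivation C K K} {t : Fin (n + 1) → K}

theorem le_hmAt {f : K} {i : Fin (n + 1)} {M : Mono n} (h : coeffs C t f i (ofColex M) ≠ 0) :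
    (M : WithBot (Mono n)) ≤ hmAt C t i f :=
  Finset.le_max (Finset.mem_image.2 ⟨_, Finsupp.mem_support_iff.2 h, rfl⟩)

theorem hmAt_le_hm (f : K) (i : Fin (n + 1)) : hmAt C t i f ≤ hm C t f :=
  Finset.le_sup (f := fun i => hmAt C t i f) (Finset.mem_univ i)

theorem hm_eq_max (f : K) : hm C t f = (monomials C t f).max := by
  refine le_antisymm (Finset.sup_le fun i _ => Finset.max_mono ?_) (Finset.max_le fun M hM => ?_)
  · exact Finset.subset_biUnion_of_mem (fun i => (coeffs C t f i).support.image toColex)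
      (Finset.mem_univ i)
  · obtain ⟨i, -, hi⟩ := Finset.mem_biUnion.1 hM
    exact (Finset.le_max hi).trans (hmAt_le_hm f i)

theorem totalCoeff_ne_zero_of_hm_eq (ht : IsPrimitive D t) {f : K} {M : Mono n}
    (h : hm C t f = M) : totalCoeff ht M f ≠ 0 := by
  rw [hm_eq_max] at h
  exact (mem_monomials ht).1 (Finset.mem_of_max h)

theorem le_hm (ht : IsPrimitive D t) {f : K} {M : Mono n} (h : totalCoeff ht M f ≠ 0) :
    (M : WithBot (Mono n)) ≤ hm C t f := by
  rw [hm_eq_max]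
  exact Finset.le_max ((mem_monomials ht).2 h)

theorem totalCoeff_eq_zero_of_hm_lt (ht : IsPrimitive D t) {f : K} {M : Mono n}
    (h : hm C t f < M) : totalCoeff ht M f = 0 := by
  by_contra h1
  exact absurd (le_hm ht h1) (not_le.2 h)

theorem hm_lt_of (ht : IsPrimitive D t) {f : K} {M : Mono n}
    (h : ∀ Q, M ≤ Q → totalCoeff ht Q f = 0) : hm C t f < M := by
  by_contra hle
  obtain ⟨Q, hQ⟩ := WithBot.ne_bot_iff_exists.1
    fun h0 : hm C t f = ⊥ => hle (h0 ▸ WithBot.bot_lt_coe M)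
  have hMQ := not_lt.1 hle
  rw [← hQ] at hMQ
  exact totalCoeff_ne_zero_of_hm_eq ht hQ.symm (h Q (WithBot.coe_le_coe.1 hMQ))

theorem hm_zero (ht : IsPrimitive D t) : hm C t (0 : K) = ⊥ := by
  rw [hm_eq_max, Finset.max_eq_bot, Finset.eq_empty_iff_forall_notMem]
  intro M hM
  exact (mem_monomials ht).1 hM (map_zero _)

theorem hm_eq_bot_iff (ht : IsPrimitive D t) {f : K} : hm C t f = ⊥ ↔ f = 0 := by
  refine ⟨fun h => ?_, fun h => by rw [h, hm_zero ht]⟩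
  rw [hm_eq_max, Finset.max_eq_bot] at h
  rw [eq_sum_totalCoeff ht f, h, Finset.sum_empty]

theorem exists_hm_eq (ht : IsPrimitive D t) {f : K} (hf : f ≠ 0) :
    ∃ M : Mono n, hm C t f = M := by
  obtain ⟨M, hM⟩ := WithBot.ne_bot_iff_exists.1
    fun h : hm C t f = ⊥ => hf ((hm_eq_bot_iff ht).1 h)
  exact ⟨M, hM.symm⟩

theorem hc_eq_totalCoeff (ht : IsPrimitive D t) {f : K} {M : Mono n} (h : hm C t f = M) :
    hc C t f = totalCoeff ht M f := by
  rw [hc, totalCoeff_apply, Finset.sum_filter]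
  refine Finset.sum_congr rfl fun i _ => ?_
  split_ifs with hi
  · rw [hcAt, hi, h]; rfl
  · by_contra hne
    exact hi (le_antisymm (hmAt_le_hm f i) (h ▸ le_hmAt (Ne.symm hne)))

theorem hc_zero (ht : IsPrimitive D t) : hc C t (0 : K) = 0 := by
  rw [hc]
  refine Finset.sum_eq_zero fun i _ => ?_
  have h : hmAt C t i (0 : K) = ⊥ := le_bot_iff.1 ((hmAt_le_hm _ i).trans (hm_zero ht).le)
  rw [hcAt, h]; rfl

/-! ### The component in the last generator -/

theorem coeffs_last_eq_zero (ht : IsPrimitive D t) (f : K) {e : Fin (n + 1) → ℕ} (he : e ≠ 0) :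
    coeffs C t f (Fin.last n) e = 0 := by
  by_contra h
  exact he (funext fun j => (isMatryoshka_coeffs ht f).inT _ e h j (Fin.le_last j))

theorem proj_last_eq (ht : IsPrimitive D t) (f : K) :
    proj C t (Fin.last n) f = coeffs C t f (Fin.last n) 0 :=
  proj_eq_of_suppIn fun _ he => by_contra fun h => he (coeffs_last_eq_zero ht f h)

theorem proj_last_isCoeff (ht : IsPrimitive D t) (f : K) :
    IsCoeff C t (Fin.last n) (proj C t (Fin.last n) f) := by
  rw [proj_last_eq ht]
  exact (isMatryoshka_coeffs ht f).isCoeff _ _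

theorem proj_last_eq_self (ht : IsPrimitive D t) {f : K} (hf : IsCoeff C t (Fin.last n) f) :
    proj C t (Fin.last n) f = f := by
  rw [proj_last_eq ht, coeffs_of_isCoeff ht hf, Pi.single_eq_same, Finsupp.single_eq_same]

theorem coeffs_rest_last (ht : IsPrimitive D t) (f : K) :
    coeffs C t (rest C t f) (Fin.last n) = 0 := by
  rw [rest, coeffs_sub ht, coeffs_proj ht, Pi.sub_apply, Pi.single_eq_same, sub_self]

theorem coeffs_rest_of_ne (ht : IsPrimitive D t) (f : K) {i : Fin (n + 1)}
    (hi : i ≠ Fin.last n) : coeffs C t (rest C t f) i = coeffs C t f i := by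
  rw [rest, coeffs_sub ht, coeffs_proj ht, Pi.sub_apply, Pi.single_eq_of_ne hi, sub_zero]

theorem totalCoeff_rest (ht : IsPrimitive D t) (f : K) {M : Mono n} (hM : M ≠ toColex 0) :
    totalCoeff ht M (rest C t f) = totalCoeff ht M f := by
  rw [totalCoeff_apply, totalCoeff_apply]
  refine Finset.sum_congr rfl fun i _ => ?_
  rcases eq_or_ne i (Fin.last n) with rfl | hi
  · rw [coeffs_rest_last ht, coeffs_last_eq_zero ht f (fun h => hM (ofColex.injective h))]
    rfl
  · rw [coeffs_rest_of_ne ht f hi]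

theorem hm_eq_hm_rest (ht : IsPrimitive D t) {f : K} {M : Mono n}
    (h : hm C t (rest C t f) = M) : hm C t f = M := by
  refine le_antisymm ?_ (le_hm ht fun h0 => totalCoeff_ne_zero_of_hm_eq ht h ?_)
  · rw [hm_eq_max]
    refine Finset.max_le fun Q hQ => ?_
    rw [mem_monomials ht] at hQ
    by_contra hlt
    rw [not_le] at hlt
    refine hQ ?_
    rw [← totalCoeff_rest ht f (ne_of_gt (lt_of_le_of_lt (zero_le_mono M)
      (WithBot.coe_lt_coe.1 hlt)))]
    exact totalCoeff_eq_zero_of_hm_lt ht (h ▸ hlt)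
  · rw [totalCoeff_eq_zero_iff] at h0 ⊢
    intro i
    rcases eq_or_ne i (Fin.last n) with rfl | hi
    · rw [coeffs_rest_last ht]; rfl
    · rw [coeffs_rest_of_ne ht f hi, h0 i]

theorem exists_coeffs_rest_ne_zero (ht : IsPrimitive D t) {f : K} {M : Mono n}
    (h : totalCoeff ht M (rest C t f) ≠ 0) : ∃ i < ind M,
      coeffs C t (rest C t f) i (ofColex M) ≠ 0 := by
  obtain ⟨i, hi⟩ : ∃ i, coeffs C t (rest C t f) i (ofColex M) ≠ 0 := by
    by_contra hcon
    push Not at hcon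
    exact h ((totalCoeff_eq_zero_iff ht).2 hcon)
  refine ⟨i, lt_ind_of_inT ((isMatryoshka_coeffs ht _).inT i _ hi) (Or.inl ?_), hi⟩
  rintro rfl
  rw [coeffs_rest_last ht] at hi
  exact hi rfl

/-- The elements without component in `P_n` are polynomials in `t_n`. -/
theorem exists_aeval_of_coeffs_last (ht : IsPrimitive D t) {f : K}
    (hf : coeffs C t f (Fin.last n) = 0) :
    ∃ R : Polynomial (below C t (Fin.last n)), f = Polynomial.aeval (t (Fin.last n)) R := by
  suffices h : f ∈ (Polynomial.aeval (R := below C t (Fin.last n)) (t (Fin.last n))).range by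
    obtain ⟨R, hR⟩ := h
    exact ⟨R, hR.symm⟩
  have hbelow : ∀ x ∈ below C t (Fin.last n),
      x ∈ (Polynomial.aeval (R := below C t (Fin.last n)) (t (Fin.last n))).range :=
    fun x hx => ⟨Polynomial.C ⟨x, hx⟩, Polynomial.aeval_C _ _⟩
  have hm := isMatryoshka_coeffs ht f
  rw [hm.sum_eq]
  refine sum_mem fun i _ => sum_mem fun e he => ?_
  have hi : i < Fin.last n := by
    refine lt_of_le_of_ne (Fin.le_last i) ?_
    rintro rfl
    rw [hf] at he
    simp at he
  refine mul_mem (hbelow _ (upto_le_below t hi (hm.isCoeff i e).mem_upto)) (prod_mem fun j _ => ?_)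
  refine pow_mem ?_ _
  rcases (Fin.le_last j).lt_or_eq with hj | rfl
  · exact hbelow _ (upto_le_below t hj (mem_upto_self t j))
  · exact ⟨Polynomial.X, Polynomial.aeval_X _⟩

theorem coeffs_last_aeval (ht : IsPrimitive D t) (h0 : 0 < Fin.last n)
    (R : Polynomial (below C t (Fin.last n))) :
    coeffs C t (Polynomial.aeval (t (Fin.last n)) R) (Fin.last n) = 0 := by
  have h : Polynomial.aeval (t (Fin.last n)) R ∈ suppIn ht fun i _ => i < Fin.last n := by
    rw [Polynomial.aeval_eq_sum_range]
    refine sum_mem fun k _ => ?_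
    have := mul_mon_mem_suppIn_of_mem_below ht h0 (R.coeff k).2 (Pi.single (Fin.last n) k)
    rw [mon_single] at this
    rw [Algebra.smul_def]
    exact suppIn_mono ht (fun i e h => h.1) this
  ext e
  by_contra hne
  exact absurd (h _ e hne) (lt_irrefl _)

end Head

/-! ### Remainders -/

section Remainder

variable {C K : Type*} [Field C] [Field K] [Algebra C K] {n : ℕ}
  {D : Derivation C K K} {t : Fin (n + 1) → K}

/-- An element in remainder form is minimal in its class modulo derivatives. A lower element
`r + u'` would have the same denominator, so `u` is a polynomial in `t_n`, and `u'` would cancel the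
head term of `r - π_n(r)`, whose coefficient is not of the form that `mem_derivSpan_of_isSimple`
prescribes. -/
theorem not_lower_of_hasRemainderForm [CharZero C] (hs : IsSPrimitive D t) {r : K}
    (hr : HasRemainderForm D t r) (u : K) : ¬ Lower C t (r + D u) r := by
  have ht := hs.toIsPrimitive
  intro hlow
  rcases hr with rfl | ⟨M, hM, hsimp, ha, hna⟩
  · rcases hlow with h | ⟨-, h⟩
    · rw [denDeg_zero ht] at h
      exact absurd h (Nat.not_lt_zero _)
    · rw [hm_zero ht] at h
      exact not_lt_bot h
  obtain ⟨R, hR⟩ := exists_aeval_of_coeffs_last ht (coeffs_rest_last ht r)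
  have hdec : r = Polynomial.aeval (t (Fin.last n)) R + proj C t (Fin.last n) r := by
    rw [← hR, rest, sub_add_cancel]
  have hle : denDeg C t (r + D u) ≤ denDeg C t r := by
    rcases hlow with h | ⟨h, -⟩
    · exact h.le
    · exact h.le
  obtain ⟨⟨U, rfl⟩, hden⟩ : (∃ U : Polynomial (below C t (Fin.last n)),
      u = Polynomial.aeval (t (Fin.last n)) U) ∧ denDeg C t (r + D u) = denDeg C t r := by
    rw [hdec] at hle
    have := exists_poly_of_denDeg_le ht hsimp hle
    rwa [← hdec] at this
  have hhm : hm C t (r + D (Polynomial.aeval (t (Fin.last n)) U)) < hm C t r := by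
    rcases hlow with h | ⟨-, h⟩
    · exact absurd hden h.ne
    · exact h
  rw [← aeval_polyDeriv ht] at hhm
  set V := polyDeriv ht (Fin.last n) U with hV
  by_cases hrest : rest C t r = 0
  · have hrp : proj C t (Fin.last n) r = r := by
      rw [rest, sub_eq_zero] at hrest
      exact hrest.symm
    have hM0 : M = toColex 0 := by
      by_contra hne
      refine totalCoeff_ne_zero_of_hm_eq ht hM ?_
      rw [← totalCoeff_rest ht r hne, hrest, map_zero]
    have hs0 : r + Polynomial.aeval (t (Fin.last n)) V = 0 := by
      by_contra hne
      obtain ⟨Q, hQ⟩ := exists_hm_eq ht hne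
      rw [hQ, hM, hM0, WithBot.coe_lt_coe] at hhm
      exact absurd (zero_le_mono Q) (not_le.2 hhm)
    have hprop := hsimp.isProper
    rw [hrp, eq_neg_of_add_eq_zero_left hs0, ← map_neg] at hprop
    have h1 := hprop.eq_zero_of_aeval (ht.transcendental _)
    rw [neg_eq_zero] at h1
    rw [h1, map_zero, add_zero] at hhm
    exact absurd hhm (lt_irrefl _)
  · obtain ⟨M', hM'⟩ := exists_hm_eq ht hrest
    obtain rfl : M' = M := WithBot.coe_injective ((hm_eq_hm_rest ht hM').symm.trans hM)
    have hne := totalCoeff_ne_zero_of_hm_eq ht hM'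
    rw [hc_eq_totalCoeff ht hM'] at ha hna
    have hlast : 0 < Fin.last n := by
      obtain ⟨i, hi, -⟩ := exists_coeffs_rest_ne_zero ht hne
      exact lt_of_le_of_lt (Fin.zero_le i) (hi.trans_le (Fin.le_last _))
    rw [hM] at hhm
    have hVM : totalCoeff ht M' (Polynomial.aeval (t (Fin.last n)) V) =
        -totalCoeff ht M' (rest C t r) := by
      rw [totalCoeff_apply, totalCoeff_apply, ← Finset.sum_neg_distrib]
      refine Finset.sum_congr rfl fun i _ => ?_
      rcases eq_or_ne i (Fin.last n) with rfl | hi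
      · rw [coeffs_rest_last ht, coeffs_last_aeval ht hlast]; simp
      · have h1 := (totalCoeff_eq_zero_iff ht).1 (totalCoeff_eq_zero_of_hm_lt ht hhm) i
        rw [coeffs_rest_of_ne ht r hi, eq_neg_iff_add_eq_zero, add_comm]
        rwa [coeffs_add ht] at h1
    rw [hV, aeval_polyDeriv] at hVM hhm
    have hspan := mem_derivSpan_of_isSimple hs (M := M')
      (u := Polynomial.aeval (t (Fin.last n)) U) (fun Q hQ => by
        have h1 := totalCoeff_eq_zero_of_hm_lt ht (hhm.trans (WithBot.coe_lt_coe.2 hQ))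
        rw [map_add, totalCoeff_eq_zero_of_hm_lt ht (hM ▸ WithBot.coe_lt_coe.2 hQ), zero_add] at h1
        exact h1) (by
        rw [hVM]
        exact neg_mem (show _ ∈ simpleSubmodule ht from ha))
    rw [hVM] at hspan
    exact hna ⟨hne, by simpa using neg_mem hspan⟩

theorem isRemainder_of_hasRemainderForm [CharZero C] (hs : IsSPrimitive D t) {f r : K}
    (hr : HasRemainderForm D t r) (hf : EqModDeriv D r f) : IsRemainder D t f r := by
  refine ⟨hf, fun s ⟨v, hv⟩ => ?_⟩
  obtain ⟨w, hw⟩ := hf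
  have : s = r + D (v - w) := by rw [map_sub, ← hv, ← hw]; ring
  rw [this]
  exact not_lower_of_hasRemainderForm hs hr _

/-- As `0` is lower than all other elements, it is the only remainder of a derivative. -/
theorem exists_deriv_iff_of_isRemainder (ht : IsPrimitive D t) {f r : K}
    (hr : IsRemainder D t f r) : (∃ u, f = D u) ↔ r = 0 := by
  constructor
  · rintro ⟨u, rfl⟩
    by_contra hne
    refine hr.2 0 ⟨-u, by rw [map_neg, zero_sub]⟩ ?_
    rcases Nat.eq_zero_or_pos (denDeg C t r) with h | h
    · refine Or.inr ⟨by rw [denDeg_zero ht, h], ?_⟩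
      rw [hm_zero ht, bot_lt_iff_ne_bot]
      exact fun h => hne ((hm_eq_bot_iff ht).1 h)
    · exact Or.inl (by rwa [denDeg_zero ht])
  · rintro rfl
    obtain ⟨u, hu⟩ := hr.1
    exact ⟨-u, by rw [map_neg, ← hu, zero_sub, neg_neg]⟩

end Remainder

/-! ### The reduction steps -/

section Steps

variable {C K : Type*} [Field C] [Field K] [Algebra C K] {n : ℕ}
  {D : Derivation C K K} {t : Fin (n + 1) → K}

/-- The sequence of steps terminates because this quantity decreases lexicographically: whether
`π_n(r)` fails to be simple, the head monomial of `r - π_n(r)`, and whether its coefficient fails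
to be simple. -/
def stepMeasure (D : Derivation C K K) (t : Fin (n + 1) → K) (r : K) :
    ℕ ×ₗ (WithBot (Mono n) ×ₗ ℕ) :=
  toLex (if IsSimpleAt D t (Fin.last n) (proj C t (Fin.last n) r) then 0 else 1,
    toLex (hm C t (rest C t r), if IsSimple D t (hc C t (rest C t r)) then 0 else 1))

theorem proj_last_sub_of_coeffs (ht : IsPrimitive D t) (r : K) {v : K}
    (hv : coeffs C t v (Fin.last n) 0 = 0) :
    proj C t (Fin.last n) (r - v) = proj C t (Fin.last n) r := by
  rw [proj_sub ht, proj_last_eq ht v, hv, sub_zero]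

theorem rest_sub_of_coeffs (ht : IsPrimitive D t) (r : K) {v : K}
    (hv : coeffs C t v (Fin.last n) 0 = 0) : rest C t (r - v) = rest C t r - v := by
  rw [rest, rest, proj_last_sub_of_coeffs ht r hv]
  ring

/-- With `m = ind M`, the sum `b = ∑_{i < m} b_i` of coefficients of the `P_i` can be a coefficient
of `M`, its components are the `b_i`, and `(b M)'` has no component in `P_n`. -/
theorem deriv_head (ht : IsPrimitive D t) {M : Mono n} {b : Fin (n + 1) → K}
    (hb : ∀ i < ind M, IsCoeff C t i (b i)) :
    (∑ i with i < ind M, b i) ∈ flat ht M ∧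
    (∀ i, coeffs C t (∑ i with i < ind M, b i) i 0 = if i < ind M then b i else 0) ∧
    coeffs C t (D ((∑ i with i < ind M, b i) * mon t (ofColex M))) (Fin.last n) 0 = 0 := by
  have hflat : (∑ i with i < ind M, b i) ∈ flat ht M := by
    refine sum_mem fun i hi => ?_
    have hi := (Finset.mem_filter.1 hi).2
    exact mem_flat_of_isCoeff ht (hb i hi) (inT_of_lt_ind hi)
  have hcoeffs : ∀ i, coeffs C t (∑ i with i < ind M, b i) i 0 =
      if i < ind M then b i else 0 := by
    intro i
    rw [Finset.sum_filter, coeffs_sum_isCoeff ht, Finsupp.single_eq_same]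
    intro j
    split_ifs with h
    · exact hb j h
    · exact .of_zero
  refine ⟨hflat, hcoeffs, ?_⟩
  have h1 : coeffs C t (D ((∑ i with i < ind M, b i) * mon t (ofColex M)) -
      D (∑ i with i < ind M, b i) * mon t (ofColex M)) (Fin.last n) 0 = 0 := by
    by_contra hne
    exact absurd (deriv_flat_mul_mon ht hflat _ _ hne).1 (lt_irrefl _)
  rw [coeffs_sub ht, Pi.sub_apply, Finsupp.sub_apply,
    coeffs_flat_mul_mon ht (deriv_mem_flat ht hflat), coeffs_deriv_of_mem_flat ht hflat,
    Finsupp.single_eq_same, hcoeffs, if_neg (not_lt.2 (Fin.le_last _)), D.map_zero,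
    Finsupp.single_zero, Finsupp.zero_apply, sub_zero] at h1
  exact h1

theorem ind_add_single {M : Mono n} {j : Fin (n + 1)} (hj : j ≤ ind M) :
    ind (toColex (ofColex M + Pi.single j 1)) = j := by
  refine le_antisymm (ind_le ?_) (le_ind fun l hl => ?_)
  · simp
  · by_contra hlt
    rw [not_le] at hlt
    have : ofColex M l = 0 := apply_eq_zero_of_lt_ind (hlt.trans_le hj)
    exact hl (by simp [this, Pi.single_eq_of_ne hlt.ne])

theorem lowerMono_add_single {M : Mono n} {j : Fin (n + 1)} (hj : j ≤ ind M) :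
    lowerMono (toColex (ofColex M + Pi.single j 1)) = M := by
  rw [lowerMono, ind_add_single hj, ofColex_toColex, add_tsub_cancel_right, toColex_ofColex]

/-- The derivative of the element `u` used to integrate by parts `(∑ c_j t_j') M` has this head
term, and no component in `P_n`. -/
theorem deriv_span [CharZero C] (hs : IsSPrimitive D t) {M : Mono n} (h0 : 0 < ind M)
    (c : Fin (n + 1) → C) {u : K}
    (hu : u = (∑ j with 0 < j ∧ j < ind M, c j • t j) * mon t (ofColex M) +
        (c (ind M) / ((M (ind M) : C) + 1)) • (t (ind M) * mon t (ofColex M))) :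
    coeffs C t (D u) (Fin.last n) 0 = 0 ∧
    ∀ W, M ≤ W → totalCoeff hs.toIsPrimitive W (D u) =
      if M = W then ∑ j with 0 < j ∧ j ≤ ind M, c j • D (t j) else 0 := by
  have ht := hs.toIsPrimitive
  let Q : Fin (n + 1) → Mono n := fun j => toColex (ofColex M + Pi.single j 1)
  have hQ : ∀ j, mon t (ofColex (Q j)) = t j * mon t (ofColex M) := fun j => by
    rw [show ofColex (Q j) = ofColex M + Pi.single j 1 from rfl, mon_add, mon_single, pow_one,
      mul_comm]
  let γ : Fin (n + 1) → C := fun j => c j / ((M j : C) + 1)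
  have hfilter : (Finset.univ.filter fun j => 0 < j ∧ j ≤ ind M) =
      insert (ind M) (Finset.univ.filter fun j => 0 < j ∧ j < ind M) := by
    ext j
    simp only [Finset.mem_filter, Finset.mem_univ, true_and, Finset.mem_insert]
    constructor
    · rintro ⟨h1, h2⟩
      rcases h2.lt_or_eq with h | h
      · exact Or.inr ⟨h1, h⟩
      · exact Or.inl h
    · rintro (rfl | h)
      · exact ⟨h0, le_rfl⟩
      · exact ⟨h.1, h.2.le⟩
  -- all summands of `u` have the form `γ_j t_j M` with a constant `γ_j`; for `j < m` the exponent
  -- of `t_j` in `M` is `0`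
  have hu' : u = ∑ j with 0 < j ∧ j ≤ ind M, γ j • mon t (ofColex (Q j)) := by
    rw [hfilter, Finset.sum_insert (by simp), hu, Finset.sum_mul, add_comm, hQ]
    refine congrArg _ (Finset.sum_congr rfl fun j hj => ?_)
    have hj0 : M j = 0 := apply_eq_zero_of_lt_ind (Finset.mem_filter.1 hj).2.2
    rw [hQ, smul_mul_assoc]
    simp only [γ]
    rw [hj0, Nat.cast_zero, zero_add, div_one]
  have hcoeff : ∀ j, 0 < j → j ≤ ind M → γ j * (Q j (ind (Q j)) : C) = c j := by
    intro j _ hj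
    have h1 : Q j (ind (Q j)) = M j + 1 := by
      rw [ind_add_single hj]
      change ofColex M j + Pi.single (M := fun _ => ℕ) j 1 j = _
      rw [Pi.single_eq_same]
      rfl
    rw [h1, Nat.cast_succ]
    exact div_mul_cancel₀ _ (Nat.cast_add_one_ne_zero _)
  constructor
  · change coeffHom ht (Fin.last n) 0 (D u) = 0
    rw [hu', map_sum, map_sum]
    refine Finset.sum_eq_zero fun j hj => ?_
    have hj := (Finset.mem_filter.1 hj).2
    have hbot : algebraMap C K (γ j) ∈ (⊥ : IntermediateField C K) :=
      IntermediateField.mem_bot.2 ⟨_, rfl⟩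
    have hflat : algebraMap C K (γ j) ∈ flat ht (Q j) :=
      mem_flat_of_isCoeff ht (isCoeff_of_mem_bot hbot)
        (inT_of_lt_ind (by rw [ind_add_single hj.2]; exact hj.1))
    have h1 := deriv_flat_mul_mon ht hflat
    rw [D.map_algebraMap, zero_mul, sub_zero, ← Algebra.smul_def] at h1
    by_contra hne
    exact absurd (h1 _ _ hne).1 (lt_irrefl _)
  · intro W hW
    rw [hu', map_sum, map_sum]
    have hterm : ∀ j ∈ Finset.univ.filter fun j => 0 < j ∧ j ≤ ind M,
        totalCoeff ht W (D (γ j • mon t (ofColex (Q j)))) =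
          if M = W then c j • D (t j) else 0 := by
      intro j hj
      have hj := (Finset.mem_filter.1 hj).2
      have hind : ind (Q j) = j := ind_add_single hj.2
      have hlow : lowerMono (Q j) = M := lowerMono_add_single hj.2
      rw [totalCoeff_deriv_smul_mon hs (by rw [hind]; exact hj.1) _ (by rw [hlow]; exact hW),
        hcoeff j hj.1 hj.2, hlow, hind]
    rw [Finset.sum_congr rfl hterm]
    split_ifs
    · rfl
    · exact Finset.sum_const_zero

theorem exists_coeff_of_mem_derivSpan {m : Fin (n + 1)} {x : K} (hx : x ∈ derivSpan D t m) :
    ∃ c : Fin (n + 1) → C, x = ∑ j with 0 < j ∧ j ≤ m, c j • D (t j) := by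
  induction hx using Submodule.span_induction with
  | mem x hx =>
    obtain ⟨j, h0, hj, rfl⟩ := hx
    refine ⟨Pi.single j 1, ?_⟩
    rw [Finset.sum_eq_single j]
    · simp
    · intro k _ hk
      rw [Pi.single_eq_of_ne hk, zero_smul]
    · exact fun h => absurd (Finset.mem_filter.2 ⟨Finset.mem_univ j, h0, hj⟩) h
  | zero => exact ⟨0, by simp⟩
  | add x y _ _ hx hy =>
    obtain ⟨c, rfl⟩ := hx
    obtain ⟨d, rfl⟩ := hy
    exact ⟨c + d, by simp [add_smul, Finset.sum_add_distrib]⟩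
  | smul a x _ hx =>
    obtain ⟨c, rfl⟩ := hx
    exact ⟨a • c, by simp [Finset.smul_sum, smul_smul]⟩

theorem stepMeasure_lt [CharZero C] (hs : IsSPrimitive D t) {s s' : K × K}
    (h : Step D t s s') : stepMeasure D t s'.2 < stepMeasure D t s.2 := by
  have ht := hs.toIsPrimitive
  cases h with
  | hermite g r b h hn hb =>
    obtain ⟨hb, hh, heq⟩ := hb
    refine Prod.Lex.toLex_lt_toLex.2 (Or.inl ?_)
    have h1 : proj C t (Fin.last n) (r - D b) = h := by
      rw [proj_sub ht, proj_last_eq_self ht (hb.deriv ht), heq, add_sub_cancel_left]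
    simp only [h1, if_pos hh, if_neg hn]
    exact one_pos
  | head g r M b h hM hn hb u hu =>
    obtain ⟨hflat, hcoeffs, hlast⟩ := deriv_head ht fun i hi => (hb i hi).1
    have hrest := totalCoeff_ne_zero_of_hm_eq ht hM
    rw [← hu] at hlast
    have htop : ∀ Q, M < Q → totalCoeff ht Q (rest C t (r - D u)) = 0 := by
      intro Q hQ
      rw [rest_sub_of_coeffs ht r hlast, map_sub, hu, totalCoeff_deriv_of_lt ht hflat hQ, sub_zero]
      exact totalCoeff_eq_zero_of_hm_lt ht (hM ▸ WithBot.coe_lt_coe.2 hQ)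
    refine Prod.Lex.toLex_lt_toLex.2 (Or.inr ⟨by simp only [proj_last_sub_of_coeffs ht r hlast],
      Prod.Lex.toLex_lt_toLex.2 ?_⟩)
    by_cases h0 : totalCoeff ht M (rest C t (r - D u)) = 0
    · left
      simp only [hM]
      exact hm_lt_of ht fun Q hQ => hQ.lt_or_eq.elim (htop Q) fun h => h ▸ h0
    · right
      have hM' : hm C t (rest C t (r - D u)) = M := by
        refine le_antisymm ?_ (le_hm ht h0)
        rw [hm_eq_max]
        refine Finset.max_le fun Q hQ => ?_
        rw [mem_monomials ht] at hQ
        by_contra hlt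
        exact hQ (htop Q (WithBot.coe_lt_coe.1 (not_le.1 hlt)))
      have hsimple : IsSimple D t (hc C t (rest C t (r - D u))) := by
        rw [hc_eq_totalCoeff ht hM] at hb
        rw [hc_eq_totalCoeff ht hM', isSimple_of_mem_flat ht (totalCoeff_mem_flat ht M _)]
        intro i
        have ha := totalCoeff_mem_flat ht M (rest C t r)
        rw [rest_sub_of_coeffs ht r hlast, map_sub, hu, totalCoeff_deriv_self ht hflat,
          coeffs_sub ht, Pi.sub_apply, Finsupp.sub_apply, coeffs_deriv_of_mem_flat ht hflat,
          Finsupp.single_eq_same, hcoeffs]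
        split_ifs with hi
        · obtain ⟨-, hh, heq⟩ := hb i hi
          rw [proj_eq_of_suppIn fun e he => (ha i e he).1] at heq
          rw [heq, add_sub_cancel_left]
          exact hh
        · rw [D.map_zero, sub_zero, coeffs_totalCoeff ht, Finsupp.single_eq_same]
          have : coeffs C t (rest C t r) i (ofColex M) = 0 := by
            by_contra hne
            refine hi (lt_ind_of_inT ((isMatryoshka_coeffs ht _).inT i _ hne) (Or.inl ?_))
            rintro rfl
            rw [coeffs_rest_last ht] at hne
            exact hne rfl
          rw [this]
          exact .zero ht
      refine ⟨by simp only [hM, hM'], ?_⟩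
      simp only [if_pos hsimple, if_neg hn]
      exact one_pos
  | span g r M c hM ha u hu =>
    obtain ⟨i, hi, -⟩ := exists_coeffs_rest_ne_zero ht (totalCoeff_ne_zero_of_hm_eq ht hM)
    obtain ⟨hlast, hW⟩ := deriv_span hs (lt_of_le_of_lt (Fin.zero_le i) hi) c hu
    refine Prod.Lex.toLex_lt_toLex.2 (Or.inr ⟨by simp only [proj_last_sub_of_coeffs ht r hlast],
      Prod.Lex.toLex_lt_toLex.2 (Or.inl ?_)⟩)
    simp only [hM]
    refine hm_lt_of ht fun Q hQ => ?_
    rw [rest_sub_of_coeffs ht r hlast, map_sub, hW Q hQ]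
    split_ifs with h
    · subst h
      rw [← ha, hc_eq_totalCoeff ht hM, sub_self]
    · rw [sub_zero]
      exact totalCoeff_eq_zero_of_hm_lt ht
        (hM ▸ WithBot.coe_lt_coe.2 (lt_of_le_of_ne hQ h))

theorem wellFounded_step [CharZero C] (hs : IsSPrimitive D t) :
    WellFounded fun s' s => Step D t s s' :=
  Subrelation.wf (fun h => stepMeasure_lt hs h)
    (InvImage.wf (fun s : K × K => stepMeasure D t s.2) wellFounded_lt)

theorem Step.invariant {s s' : K × K} (h : Step D t s s') : D s'.1 + s'.2 = D s.1 + s.2 := by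
  cases h <;> simp

theorem invariant_of_reachable {s s' : K × K} (h : Relation.ReflTransGen (Step D t) s s') :
    D s'.1 + s'.2 = D s.1 + s.2 := by
  induction h with
  | refl => rfl
  | tail _ h ih => rw [h.invariant, ih]

/-- If no step applies, then `r` has the form of a remainder, as Hermite reductions exist. -/
theorem Done.hasRemainderForm [CharZero C] (hs : IsSPrimitive D t) {g r : K}
    (h : Done D t (g, r)) : HasRemainderForm D t r := by
  have ht := hs.toIsPrimitive
  refine or_iff_not_imp_left.2 fun hr => ?_
  obtain ⟨M, hM⟩ := exists_hm_eq ht hr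
  refine ⟨M, hM, ?_, ?_⟩
  · by_contra hn
    obtain ⟨b, k, hb⟩ := (proj_last_isCoeff ht r).exists_hermite ht
    exact h _ (.hermite g r b k hn hb)
  · by_cases hrest : rest C t r = 0
    · rw [hrest, hc_zero ht]
      exact ⟨zero_mem (simpleSubmodule ht), fun h => h.1 rfl⟩
    obtain ⟨M', hM'⟩ := exists_hm_eq ht hrest
    obtain rfl : M' = M := WithBot.coe_injective ((hm_eq_hm_rest ht hM').symm.trans hM)
    refine ⟨?_, fun hspan => ?_⟩
    · by_contra hn
      have ha := totalCoeff_mem_flat ht M' (rest C t r)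
      rw [← hc_eq_totalCoeff ht hM'] at ha
      have hex : ∀ i, ∃ b k, IsHermite D t i (proj C t i (hc C t (rest C t r))) b k := by
        intro i
        rw [proj_eq_of_suppIn fun e he => (ha i e he).1]
        exact ((isMatryoshka_coeffs ht _).isCoeff i 0).exists_hermite ht
      choose b k hb using hex
      exact h _ (.head g r M' b k hM' hn (fun i _ => hb i) _ rfl)
    · obtain ⟨c, hc⟩ := exists_coeff_of_mem_derivSpan hspan.2
      exact h _ (.span g r M' c hM' hc _ rfl)

end Steps

end PrimitiveTower

end

theorem theorem4p9 {C K : Type*} [Field C] [CharZero C] [Field K] [Algebra C K] {n : ℕ}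
    (D : Derivation C K K) (t : Fin (n + 1) → K) (ht : PrimitiveTower.IsSPrimitive D t) (f : K) :
    (¬ ∃ s : ℕ → K × K, s 0 = (0, f) ∧ ∀ k, PrimitiveTower.Step D t (s k) (s (k + 1))) ∧
    (∃ g r, Relation.ReflTransGen (PrimitiveTower.Step D t) (0, f) (g, r) ∧
      PrimitiveTower.Done D t (g, r)) ∧
    (∀ g r, Relation.ReflTransGen (PrimitiveTower.Step D t) (0, f) (g, r) →
      PrimitiveTower.Done D t (g, r) →
      f = D g + r ∧ PrimitiveTower.HasRemainderForm D t r ∧ PrimitiveTower.IsRemainder D t f r) ∧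
    (∀ r, PrimitiveTower.IsRemainder D t f r → ((∃ u, f = D u) ↔ r = 0)) := by
  have hwf := PrimitiveTower.wellFounded_step ht
  refine ⟨?_, ?_, ?_, fun r hr =>
    PrimitiveTower.exists_deriv_iff_of_isRemainder ht.toIsPrimitive hr⟩
  · rintro ⟨s, -, hstep⟩
    obtain ⟨_, ⟨k, rfl⟩, hk⟩ := hwf.has_min (Set.range s) ⟨s 0, 0, rfl⟩
    exact hk (s (k + 1)) ⟨k + 1, rfl⟩ (hstep k)
  · obtain ⟨s, hs, hmin⟩ := hwf.has_min
      {s | Relation.ReflTransGen (PrimitiveTower.Step D t) (0, f) s} ⟨(0, f), .refl⟩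
    exact ⟨s.1, s.2, hs, fun s' h => hmin s' (hs.tail h) h⟩
  · intro g r hreach hdone
    have hinv : D g + r = f := by
      simpa using PrimitiveTower.invariant_of_reachable hreach
    have hform := PrimitiveTower.Done.hasRemainderForm ht hdone
    refine ⟨hinv.symm, hform, PrimitiveTower.isRemainder_of_hasRemainderForm ht hform
      ⟨-g, ?_⟩⟩
    rw [map_neg, ← hinv]
    ring
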